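/- Let $\mathbb D$ be the open unit disk and $dA=\pi^{-1}dx\,dy$. Let $\omega\ge 0$ be a radial weight on $\mathbb D$, i.e. $\omega$ is integrable on $\mathbb D$, $\omega(z)=\omega(|z|)$, and $\widehat\omega(r)=\int_r^1\omega(s)\,ds\neq 0$ for all $0\le r<1$. Assume that $\omega\in\mathcal D$ (two-sided doubling): there exist $C>0$ such that $\widehat\omega(r)\le C\,\widehat\omega\left(\frac{1+r}{2}\right)$ for all $0\le r<1$, and $K>1$, $C'>1$ such that $\widehat\omega(r)\ge C'\,\widehat\omega\left(1-\frac{1-r}{K}\right)$ for all $0\le r<1$. Let $A^2_\omega$ be the space of analytic functions $f$ on $\mathbb D$ with $\int_{\mathbb D}|f|^2\omega\,dA<\infty$. Let $X$ be either $C$, the space of continuous functions $\overline{\mathbb D}\to\mathbb C$, or $C_0$, its subspace of functions vanishing on $\partial\mathbb D$, with the supremum norm $\|\cdot\|_\infty$. Let $\mathcal B_0$ be the little Bloch space: the analytic functions $f$ on $\mathbb D$ with $$\|f\|_{\mathcal B}=\sup_{z\in\mathbb D}(1-|z|^2)|f'(z)|+|f(0)|<\infty\quad\text{and}\quad \lim_{|z|\to1^-}(1-|z|^2)|f'(z)|=0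 .$$ Then $A^2_\omega$ has a reproducing (Bergman) kernel $B^\omega_z\in A^2_\omega$ at every $z\in\mathbb D$, that is, $f(z)=\int_{\mathbb D}f\,\overline{B_z^\omega}\,\omega\,dA$ for all $f\in A^2_\omega$; the integral $$P_\omega\Phi(z)=\int_{\mathbb D}\Phi(\xi)\overline{B_z^\omega(\xi)}\,\omega(\xi)\,dA(\xi)$$ converges absolutely for all $\Phi\in X$ and $z\in\mathbb D$; and the Bergman projection $P_\omega$ maps $X$ boundedly onto $\mathcal B_0$: there is a constant $M$ such that $P_\omega\Phi\in\mathcal B_0$ and $\|P_\omega\Phi\|_{\mathcal B}\le M\|\Phi\|_\infty$ for all $\Phi\in X$, and every $h\in\mathcal B_0$ equals $P_\omega\Phi$ for some $\Phi\in X$. -/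

import Mathlib

open MeasureTheory Set Filter Topology Metric
open scoped NNReal ENNReal ComplexConjugate

noncomputable section

/-- Normalized area measure `dA = π⁻¹ dx dy` on the open unit disk. -/
def diskArea : Measure ℂ :=
  (ENNReal.ofReal Real.pi)⁻¹ • (volume.restrict (ball (0 : ℂ) 1))

/-- The tail integral `∫_r^1 ω(s) ds` of a radial function, as an extended non-negative number. -/
def weightTail (ω : ℂ → ℝ) (r : ℝ) : ℝ≥0∞ :=
  ∫⁻ s in Ioo r 1, ENNReal.ofReal (ω (s : ℂ))

/-- Radial weights on the unit disk, with nowhere vanishing tail integral. -/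
structure IsRadialWeight (ω : ℂ → ℝ) : Prop where
  nonneg : ∀ z ∈ ball (0 : ℂ) 1, 0 ≤ ω z
  integrable : Integrable ω diskArea
  radial : ∀ z ∈ ball (0 : ℂ) 1, ω z = ω ((‖z‖ : ℝ) : ℂ)
  tail_ne_zero : ∀ r ∈ Ico (0 : ℝ) 1, weightTail ω r ≠ 0

/-- The upper doubling condition. -/
def IsUpperDoubling (ω : ℂ → ℝ) : Prop :=
  ∃ C : ℝ, 0 < C ∧ ∀ r ∈ Ico (0 : ℝ) 1,
    weightTail ω r ≤ ENNReal.ofReal C * weightTail ω ((1 + r) / 2)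

/-- The lower (reverse) doubling condition. -/
def IsLowerDoubling (ω : ℂ → ℝ) : Prop :=
  ∃ K C : ℝ, 1 < K ∧ 1 < C ∧ ∀ r ∈ Ico (0 : ℝ) 1,
    ENNReal.ofReal C * weightTail ω (1 - (1 - r) / K) ≤ weightTail ω r

/-- Two-sided doubling radial weights. -/
structure IsDoublingWeight (ω : ℂ → ℝ) : Prop extends IsRadialWeight ω where
  upper : IsUpperDoubling ω
  lower : IsLowerDoubling ω

/-- Membership in the weighted Bergman space `A²_ω`. -/
def MemBergmanTwo (ω : ℂ → ℝ) (f : ℂ → ℂ) : Prop :=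
  DifferentiableOn ℂ f (ball 0 1) ∧ Integrable (fun ξ => ‖f ξ‖ ^ 2 * ω ξ) diskArea

/-- `k` is a reproducing kernel of `A²_ω` at the point `z`. -/
def IsReproducingKernelAt (ω : ℂ → ℝ) (z : ℂ) (k : ℂ → ℂ) : Prop :=
  MemBergmanTwo ω k ∧
    ∀ f : ℂ → ℂ, MemBergmanTwo ω f →
      f z = ∫ ξ, f ξ * conj (k ξ) * (ω ξ : ℂ) ∂diskArea

open Classical in
/-- The Bergman kernel `B_z^ω(ξ)`: the reproducing kernel of `A²_ω` at `z`. -/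
def bergmanKernel (ω : ℂ → ℝ) (z : ℂ) : ℂ → ℂ :=
  if h : ∃ k, IsReproducingKernelAt ω z k then h.choose else 0

/-- The integrand defining the Bergman projection. -/
def bergmanIntegrand (ω : ℂ → ℝ) (Φ : ℂ → ℂ) (z ξ : ℂ) : ℂ :=
  Φ ξ * conj (bergmanKernel ω z ξ) * (ω ξ : ℂ)

/-- The Bergman projection `P_ω`. -/
def bergmanProjection (ω : ℂ → ℝ) (Φ : ℂ → ℂ) (z : ℂ) : ℂ :=
  ∫ ξ, bergmanIntegrand ω Φ z ξ ∂diskArea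

/-- A continuous function on the closed disk, extended by zero to the plane. -/
def diskExtend (Φ : C(closedBall (0 : ℂ) 1, ℂ)) : ℂ → ℂ :=
  Function.extend Subtype.val Φ 0

/-- The space `C₀` of continuous functions on the closed disk with zero boundary values. -/
def diskCZero : Submodule ℂ C(closedBall (0 : ℂ) 1, ℂ) where
  carrier := {Φ | ∀ z : closedBall (0 : ℂ) 1, ‖(z : ℂ)‖ = 1 → Φ z = 0}
  add_mem' := by
    intro a b ha hb z hz
    simp [ha z hz, hb z hz]
  zero_mem' := by
    intro z _
    rfl
  smul_mem' := by
    intro c a ha z hz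
    simp [ha z hz]

/-- The Bloch norm `sup (1 - |z|²)|f'(z)| + |f(0)|`, possibly infinite. -/
def blochNorm (f : ℂ → ℂ) : ℝ≥0∞ :=
  (⨆ z ∈ ball (0 : ℂ) 1, ENNReal.ofReal ((1 - ‖z‖ ^ 2) * ‖deriv f z‖)) + ‖f 0‖ₑ

/-- The Bloch space. -/
def MemBloch (f : ℂ → ℂ) : Prop :=
  DifferentiableOn ℂ f (ball 0 1) ∧ blochNorm f < ∞

/-- The little Bloch space. -/
def MemLittleBloch (f : ℂ → ℂ) : Prop :=
  MemBloch f ∧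
    Tendsto (fun z : ℂ => (1 - ‖z‖ ^ 2) * ‖deriv f z‖) (comap norm (𝓝[<] (1 : ℝ))) (𝓝 0)

end

/-!
In polar coordinates the radial weight becomes a measure `μ` on `(0, 1)`, and the monomials are
orthogonal in `A²_ω` with `‖zⁿ‖² = ∫ t²ⁿ dμ(t)`, so that `B_z(ξ) = ∑ (conj z * ξ)ⁿ / ∫ t²ⁿ dμ(t)`.

*Boundedness.* Upper doubling controls the moments well enough that Cauchy–Schwarz and Parseval on
circles give `∫ |∂B_z| ω dA ≲ 1 / (1 - |z|)`, where `∂` is the derivative with respect to `conj z`,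
whence `P_ω` maps bounded functions into the Bloch space. The projections of the monomials in `ξ`
and `conj ξ` are polynomials, and these monomials span a dense subspace of the continuous functions,
so `P_ω` maps into the little Bloch space.

*Surjectivity.* The Taylor coefficients of `P_ω Φ` are the moments of those of `Φ` on circles,
divided by `∫ t²ⁿ dμ(t)`. With the tail mass `T(s) = μ (s, 1)` one has
`∫ t²ᵏ⁺² dμ(t) = 2 (k + 1) ∫ T(s) s²ᵏ⁺¹ ds`. By lower doubling `(s, 1 - (1 - s) / K]` carries a
fixed proportion of the mass `T(s)`, which can therefore be swept back to this interval with a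
bounded density. Sweeping the derivative of `h` in this way, and correcting the constant term,
yields a continuous `Φ` with `P_ω Φ = h`; as the sweeping is local, `Φ` vanishes on the boundary
when `h` is in the little Bloch space.
-/

noncomputable section

open scoped Real

section CircleAverages

/-- The constant `r` bounds the values at which the series is evaluated, so that termwise
integration is dominated by `‖F‖ * ‖a n‖ * r ^ n`. -/
lemma hasSum_integral_mul_powerSeries {α : Type*} [MeasurableSpace α] {ν : Measure α}
    {F φ : α → ℂ} (hF : Integrable F ν) (hφ : AEStronglyMeasurable φ ν) {r : ℝ}
    (hφr : ∀ᵐ x ∂ν, ‖φ x‖ ≤ r) {a : ℕ → ℂ} (ha : Summable fun n => ‖a n‖ * r ^ n) :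
    HasSum (fun n => a n * ∫ x, F x * φ x ^ n ∂ν) (∫ x, F x * ∑' n, a n * φ x ^ n ∂ν) := by
  have hbound (n : ℕ) : ∀ᵐ x ∂ν, ‖F x * (a n * φ x ^ n)‖ ≤ ‖a n‖ * r ^ n * ‖F x‖ := by
    filter_upwards [hφr] with x hx
    rw [norm_mul, norm_mul, norm_pow, mul_comm]
    gcongr
  have hint (n : ℕ) : Integrable (fun x => F x * (a n * φ x ^ n)) ν :=
    (hF.norm.const_mul _).mono' (hF.aestronglyMeasurable.mul ((hφ.pow n).const_mul _)) (hbound n)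
  have hsum : Summable fun n => ∫ x, ‖F x * (a n * φ x ^ n)‖ ∂ν := by
    refine .of_nonneg_of_le (fun n => by positivity) (fun n => ?_)
      (ha.mul_right (∫ x, ‖F x‖ ∂ν))
    rw [← integral_const_mul]
    exact integral_mono_ae (hint n).norm (hF.norm.const_mul _) (hbound n)
  convert! hasSum_integral_of_summable_integral_norm hint hsum using 1
  · simp only [mul_left_comm (F _), integral_const_mul]
  · simp only [tsum_mul_left]

/-- Normalized arc length `dθ / 2π` on `(-π, π)`, the angular part of the area measure in polar
coordinates. -/
def angleMeasure : Measure ℝ :=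
  (ENNReal.ofReal (2 * π))⁻¹ • volume.restrict (Ioo (-π) π)

instance : IsProbabilityMeasure angleMeasure where
  measure_univ := by
    simp only [angleMeasure, Measure.smul_apply, Measure.restrict_apply MeasurableSet.univ,
      univ_inter, Real.volume_Ioo, smul_eq_mul, sub_neg_eq_add, ← two_mul]
    exact ENNReal.inv_mul_cancel (by simp [Real.pi_pos]) ENNReal.ofReal_ne_top

lemma integrable_angleMeasure_of_continuous {E : Type*} [NormedAddCommGroup E] {f : ℝ → E}
    (hf : Continuous f) : Integrable f angleMeasure :=
  (hf.integrableOn_Icc.mono_set Ioo_subset_Icc_self).smul_measure (by simp [Real.pi_pos])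

lemma integral_angleMeasure_exp (k : ℤ) :
    ∫ θ, Complex.exp (k * θ * Complex.I) ∂angleMeasure = if k = 0 then 1 else 0 := by
  rcases eq_or_ne k 0 with rfl | hk
  · simp
  have hperiod : Complex.exp (k * Complex.I * π) = Complex.exp (k * Complex.I * (-π : ℝ)) :=
    Complex.exp_eq_exp_iff_exists_int.2 ⟨k, by push_cast; ring⟩
  simp_rw [if_neg hk, mul_right_comm]
  rw [angleMeasure, integral_smul_measure, ← integral_Ioc_eq_integral_Ioo,
    ← intervalIntegral.integral_of_le (by linarith [Real.pi_pos]),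
    integral_exp_mul_complex (by simp [hk]), hperiod]
  simp

lemma circleMap_pow_mul_conj_pow (t θ : ℝ) (m n : ℕ) :
    circleMap 0 t θ ^ m * conj (circleMap 0 t θ) ^ n =
      (t : ℂ) ^ (m + n) * Complex.exp (((m : ℤ) - n : ℤ) * θ * Complex.I) := by
  rw [conj_circleMap_zero, circleMap_zero_pow, circleMap_zero_pow, circleMap_zero,
    circleMap_zero, Complex.ofReal_pow, Complex.ofReal_pow, mul_mul_mul_comm, ← pow_add,
    ← Complex.exp_add]
  push_cast
  ring_nf

lemma integral_circleMap_pow_mul_conj_pow (t : ℝ) (m n : ℕ) :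
    ∫ θ, circleMap 0 t θ ^ m * conj (circleMap 0 t θ) ^ n ∂angleMeasure =
      if m = n then (t : ℂ) ^ (2 * n) else 0 := by
  simp_rw [circleMap_pow_mul_conj_pow, integral_const_mul, integral_angleMeasure_exp,
    sub_eq_zero, Nat.cast_inj, mul_ite, mul_one, mul_zero]
  exact ite_congr rfl (fun h => by rw [h, two_mul]) fun _ => rfl

variable {a : ℕ → ℂ} {t : ℝ}

lemma integral_tsum_circleMap_mul_conj_pow (ht : 0 ≤ t)
    (ha : Summable fun k => ‖a k‖ * t ^ k) (n : ℕ) :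
    ∫ θ, (∑' k, a k * circleMap 0 t θ ^ k) * conj (circleMap 0 t θ) ^ n ∂angleMeasure =
      a n * (t : ℂ) ^ (2 * n) := by
  have hcont : Continuous fun θ => conj (circleMap 0 t θ) ^ n := by fun_prop
  have h := hasSum_integral_mul_powerSeries (integrable_angleMeasure_of_continuous hcont)
    (continuous_circleMap 0 t).aestronglyMeasurable (r := t)
    (.of_forall fun θ => by rw [norm_circleMap_zero, abs_of_nonneg ht]) ha
  simp_rw [mul_comm (conj _ ^ n), integral_circleMap_pow_mul_conj_pow] at h
  rw [← h.tsum_eq, tsum_eq_single n fun k hk => by simp [hk], if_pos rfl]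

lemma continuous_tsum_mul_circleMap_pow (ht : 0 ≤ t) (ha : Summable fun k => ‖a k‖ * t ^ k) :
    Continuous fun θ => ∑' k, a k * circleMap 0 t θ ^ k :=
  continuous_tsum (fun k => by fun_prop) ha fun k θ => by simp [abs_of_nonneg ht]

lemma integral_norm_sq_tsum_circleMap (ht : 0 ≤ t) (ha : Summable fun k => ‖a k‖ * t ^ k) :
    ∫ θ, ‖∑' k, a k * circleMap 0 t θ ^ k‖ ^ 2 ∂angleMeasure =
      ∑' k, ‖a k‖ ^ 2 * t ^ (2 * k) := by
  have hconj : Continuous fun θ => conj (circleMap 0 t θ) := by fun_prop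
  have h := hasSum_integral_mul_powerSeries (a := fun k => conj (a k))
    (integrable_angleMeasure_of_continuous (continuous_tsum_mul_circleMap_pow ht ha))
    hconj.aestronglyMeasurable (r := t) (.of_forall fun θ => by simp [abs_of_nonneg ht])
    (by simpa only [RCLike.norm_conj] using ha)
  have hsq (θ : ℝ) : (∑' k, a k * circleMap 0 t θ ^ k) *
      ∑' k, conj (a k) * conj (circleMap 0 t θ) ^ k =
        ((‖∑' k, a k * circleMap 0 t θ ^ k‖ ^ 2 : ℝ) : ℂ) := by
    simp only [← map_pow, ← map_mul, ← Complex.conj_tsum]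
    rw [Complex.mul_conj']
    push_cast
    rfl
  simp_rw [hsq, integral_tsum_circleMap_mul_conj_pow ht ha, ← mul_assoc, Complex.conj_mul',
    integral_complex_ofReal] at h
  exact_mod_cast h.tsum_eq.symm

end CircleAverages

section PolarCoordinates

/-- The radial part `2 t dt` on `(0, 1)` of the normalized area measure of the disk. -/
def radiusMeasure : Measure ℝ :=
  (volume.restrict (Ioo (0 : ℝ) 1)).withDensity fun t => ENNReal.ofReal (2 * t)

/-- The measure `ω dA` on the disk. -/
def weightMeasure (ω : ℂ → ℝ) : Measure ℂ :=
  diskArea.withDensity fun z => ENNReal.ofReal (ω z)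

/-- The radial part `2 t ω(t) dt` on `(0, 1)` of the measure `ω dA`. -/
def radialMeasure (ω : ℂ → ℝ) : Measure ℝ :=
  radiusMeasure.withDensity fun t => ENNReal.ofReal (ω t)

instance : SFinite radiusMeasure := by unfold radiusMeasure; infer_instance

instance (ω : ℂ → ℝ) : SFinite (radialMeasure ω) := by unfold radialMeasure; infer_instance

lemma ae_radiusMeasure_mem_Ioo : ∀ᵐ t ∂radiusMeasure, t ∈ Ioo (0 : ℝ) 1 :=
  (withDensity_absolutelyContinuous _ _).ae_le (ae_restrict_mem measurableSet_Ioo)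

lemma ae_radialMeasure_mem_Ioo (ω : ℂ → ℝ) : ∀ᵐ t ∂radialMeasure ω, t ∈ Ioo (0 : ℝ) 1 :=
  (withDensity_absolutelyContinuous _ _).ae_le ae_radiusMeasure_mem_Ioo

lemma radialMeasure_absolutelyContinuous (ω : ℂ → ℝ) : radialMeasure ω ≪ volume :=
  ((withDensity_absolutelyContinuous _ _).trans (withDensity_absolutelyContinuous _ _)).trans
    Measure.restrict_le_self.absolutelyContinuous

instance (ω : ℂ → ℝ) : NullSingletonClass (radialMeasure ω) where
  measure_singleton t := radialMeasure_absolutelyContinuous ω (measure_singleton t)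

lemma ae_diskArea_mem_ball : ∀ᵐ z ∂diskArea, z ∈ ball (0 : ℂ) 1 :=
  Measure.smul_absolutelyContinuous.ae_le (ae_restrict_mem measurableSet_ball)

lemma ae_weightMeasure_mem_ball (ω : ℂ → ℝ) : ∀ᵐ z ∂weightMeasure ω, z ∈ ball (0 : ℂ) 1 :=
  (withDensity_absolutelyContinuous _ _).ae_le ae_diskArea_mem_ball

lemma aestronglyMeasurable_weightMeasure {ω : ℂ → ℝ} {E : Type*} [NormedAddCommGroup E]
    {F : ℂ → E} (hF : ContinuousOn F (ball 0 1)) : AEStronglyMeasurable F (weightMeasure ω) :=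
  (hF.aestronglyMeasurable measurableSet_ball).mono_ac
    ((withDensity_absolutelyContinuous _ _).trans Measure.smul_absolutelyContinuous)

lemma measurable_circleMap_uncurry : Measurable fun p : ℝ × ℝ => circleMap 0 p.1 p.2 :=
  (by fun_prop : Continuous fun p : ℝ × ℝ => circleMap 0 p.1 p.2).measurable

lemma setLIntegral_ball_eq_circleMap (f : ℂ → ℝ≥0∞) :
    ∫⁻ z in ball (0 : ℂ) 1, f z =
      ∫⁻ p in Ioo (0 : ℝ) 1 ×ˢ Ioo (-π) π, ENNReal.ofReal p.1 * f (circleMap 0 p.1 p.2) := by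
  have hsymm (p : ℝ × ℝ) : Complex.polarCoord.symm p = circleMap 0 p.1 p.2 := by
    rw [Complex.polarCoord_symm_apply, circleMap_zero, Complex.exp_mul_I]
    simp
  rw [← lintegral_indicator measurableSet_ball, ← Complex.lintegral_comp_polarCoord_symm,
    ← lintegral_indicator (measurableSet_Ioo.prod measurableSet_Ioo), polarCoord_target,
    ← lintegral_indicator (measurableSet_Ioi.prod measurableSet_Ioo)]
  simp_rw [hsymm]
  congr 1 with p
  by_cases hp : 0 < p.1
  · by_cases hp1 : p.1 < 1 <;> simp [indicator, hp, hp1, abs_of_pos hp, mem_prod]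
  · simp [indicator, hp, mem_prod]

lemma measurePreserving_circleMap_diskArea :
    MeasurePreserving (fun p : ℝ × ℝ => circleMap 0 p.1 p.2)
      (radiusMeasure.prod angleMeasure) diskArea := by
  refine ⟨measurable_circleMap_uncurry, Measure.ext_of_lintegral _ fun F hF => ?_⟩
  have hFp : Measurable fun p : ℝ × ℝ => F (circleMap 0 p.1 p.2) :=
    hF.comp measurable_circleMap_uncurry
  rw [lintegral_map hF measurable_circleMap_uncurry, lintegral_prod _ hFp.aemeasurable,
    radiusMeasure, lintegral_withDensity_eq_lintegral_mul _ (by fun_prop) hFp.lintegral_prod_right',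
    diskArea, lintegral_smul_measure, setLIntegral_ball_eq_circleMap, Measure.volume_eq_prod,
    ← Measure.prod_restrict, lintegral_prod _ (by fun_prop), smul_eq_mul,
    ← lintegral_const_mul' _ _ (by simp [Real.pi_pos])]
  refine setLIntegral_congr_fun measurableSet_Ioo fun t _ => ?_
  have hFt : Measurable fun θ => F (circleMap 0 t θ) := hFp.comp measurable_prodMk_left
  simp only [Pi.mul_apply, angleMeasure, lintegral_smul_measure, smul_eq_mul]
  rw [lintegral_const_mul _ hFt, ENNReal.ofReal_mul zero_le_two,
    ENNReal.ofReal_mul zero_le_two, ENNReal.mul_inv (by simp) (by simp)]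
  generalize ∫⁻ θ in Ioo (-π) π, F (circleMap 0 t θ) = I
  calc ENNReal.ofReal 2 * ENNReal.ofReal t *
        ((ENNReal.ofReal 2)⁻¹ * (ENNReal.ofReal π)⁻¹ * I)
      = (ENNReal.ofReal 2 * (ENNReal.ofReal 2)⁻¹) *
          ((ENNReal.ofReal π)⁻¹ * (ENNReal.ofReal t * I)) := by ring
    _ = (ENNReal.ofReal π)⁻¹ * (ENNReal.ofReal t * I) := by
      rw [ENNReal.mul_inv_cancel (by simp) (by simp), one_mul]

end PolarCoordinates

namespace IsRadialWeight

variable {ω : ℂ → ℝ}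

lemma eq_circleMap (hω : IsRadialWeight ω) {t : ℝ} (ht : t ∈ Ioo (0 : ℝ) 1) (θ : ℝ) :
    ω (circleMap 0 t θ) = ω t := by
  rw [hω.radial _ (by simpa [abs_of_pos ht.1] using ht.2), norm_circleMap_zero, abs_of_pos ht.1]

lemma aemeasurable_diskArea (hω : IsRadialWeight ω) :
    AEMeasurable (fun z => ENNReal.ofReal (ω z)) diskArea :=
  hω.integrable.aestronglyMeasurable.aemeasurable.ennreal_ofReal

/-- Measurability of `ω` on a ray does not follow from measurability on the disk by
restriction, the ray being null; but almost every ray inherits it, and all rays are alike. -/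
lemma aemeasurable_radiusMeasure (hω : IsRadialWeight ω) :
    AEMeasurable (fun t : ℝ => ENNReal.ofReal (ω t)) radiusMeasure := by
  have hprod : AEMeasurable (fun p : ℝ × ℝ => ENNReal.ofReal (ω (circleMap 0 p.1 p.2)))
      (radiusMeasure.prod angleMeasure) :=
    hω.aemeasurable_diskArea.comp_quasiMeasurePreserving
      measurePreserving_circleMap_diskArea.quasiMeasurePreserving
  obtain ⟨θ, hθ⟩ := hprod.aestronglyMeasurable.prodMk_right.exists
  refine hθ.aemeasurable.congr ?_
  filter_upwards [ae_radiusMeasure_mem_Ioo] with t ht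
  rw [hω.eq_circleMap ht]

lemma measurePreserving_circleMap (hω : IsRadialWeight ω) :
    MeasurePreserving (fun p : ℝ × ℝ => circleMap 0 p.1 p.2)
      ((radialMeasure ω).prod angleMeasure) (weightMeasure ω) := by
  refine ⟨measurable_circleMap_uncurry, Measure.ext_of_lintegral _ fun F hF => ?_⟩
  have hFp : Measurable fun p : ℝ × ℝ => F (circleMap 0 p.1 p.2) :=
    hF.comp measurable_circleMap_uncurry
  have hωF : AEMeasurable (fun z => ENNReal.ofReal (ω z) * F z) diskArea :=
    hω.aemeasurable_diskArea.mul hF.aemeasurable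
  rw [lintegral_map hF measurable_circleMap_uncurry, lintegral_prod _ hFp.aemeasurable,
    radialMeasure, lintegral_withDensity_eq_lintegral_mul₀ hω.aemeasurable_radiusMeasure
      hFp.lintegral_prod_right'.aemeasurable,
    weightMeasure, lintegral_withDensity_eq_lintegral_mul₀ hω.aemeasurable_diskArea
      hF.aemeasurable]
  simp only [Pi.mul_apply]
  rw [← measurePreserving_circleMap_diskArea.map_eq] at hωF ⊢
  have hωFp : AEMeasurable (fun p : ℝ × ℝ =>
      ENNReal.ofReal (ω (circleMap 0 p.1 p.2)) * F (circleMap 0 p.1 p.2))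
      (radiusMeasure.prod angleMeasure) := hωF.comp_measurable measurable_circleMap_uncurry
  rw [lintegral_map' hωF measurable_circleMap_uncurry.aemeasurable, lintegral_prod _ hωFp]
  refine lintegral_congr_ae ?_
  filter_upwards [ae_radiusMeasure_mem_Ioo] with t ht
  have hFt : Measurable fun θ => F (circleMap 0 t θ) := hFp.comp measurable_prodMk_left
  simp only [hω.eq_circleMap ht, lintegral_const_mul _ hFt]

lemma isFiniteMeasure_weightMeasure (hω : IsRadialWeight ω) :
    IsFiniteMeasure (weightMeasure ω) :=
  isFiniteMeasure_withDensity_ofReal hω.integrable.2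

lemma isFiniteMeasure_radialMeasure (hω : IsRadialWeight ω) :
    IsFiniteMeasure (radialMeasure ω) := by
  have := hω.isFiniteMeasure_weightMeasure
  have hmass := hω.measurePreserving_circleMap.measure_preimage nullMeasurableSet_univ
  rw [preimage_univ, ← univ_prod_univ, Measure.prod_prod, measure_univ (μ := angleMeasure),
    mul_one] at hmass
  exact ⟨hmass ▸ measure_lt_top _ _⟩

lemma integrable_weightMeasure_iff (hω : IsRadialWeight ω) {E : Type*} [NormedAddCommGroup E]
    [NormedSpace ℝ E] {F : ℂ → E} :
    Integrable F (weightMeasure ω) ↔ Integrable (fun ξ => ω ξ • F ξ) diskArea := by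
  rw [weightMeasure, integrable_withDensity_iff_integrable_smul₀' hω.aemeasurable_diskArea
    (by simp)]
  refine integrable_congr ?_
  filter_upwards [ae_diskArea_mem_ball] with z hz
  rw [ENNReal.toReal_ofReal (hω.nonneg z hz)]

lemma integral_weightMeasure (hω : IsRadialWeight ω) {E : Type*} [NormedAddCommGroup E]
    [NormedSpace ℝ E] (F : ℂ → E) :
    ∫ ξ, F ξ ∂weightMeasure ω = ∫ ξ, ω ξ • F ξ ∂diskArea := by
  rw [weightMeasure, integral_withDensity_eq_integral_toReal_smul₀ hω.aemeasurable_diskArea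
    (by simp)]
  refine integral_congr_ae ?_
  filter_upwards [ae_diskArea_mem_ball] with z hz
  rw [ENNReal.toReal_ofReal (hω.nonneg z hz)]

lemma integral_weightMeasure_circleMap (hω : IsRadialWeight ω) {E : Type*}
    [NormedAddCommGroup E] [NormedSpace ℝ E] {F : ℂ → E} (hF : Integrable F (weightMeasure ω)) :
    ∫ ξ, F ξ ∂weightMeasure ω =
      ∫ t, ∫ θ, F (circleMap 0 t θ) ∂angleMeasure ∂radialMeasure ω := by
  rw [← hω.measurePreserving_circleMap.map_eq] at hF ⊢
  rw [integral_map measurable_circleMap_uncurry.aemeasurable hF.aestronglyMeasurable]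
  exact integral_prod _ (hF.comp_measurable measurable_circleMap_uncurry)

lemma lintegral_weightMeasure_circleMap (hω : IsRadialWeight ω) {F : ℂ → ℝ≥0∞}
    (hF : AEMeasurable F (weightMeasure ω)) :
    ∫⁻ ξ, F ξ ∂weightMeasure ω =
      ∫⁻ t, ∫⁻ θ, F (circleMap 0 t θ) ∂angleMeasure ∂radialMeasure ω := by
  rw [← hω.measurePreserving_circleMap.map_eq] at hF ⊢
  rw [lintegral_map' hF measurable_circleMap_uncurry.aemeasurable]
  exact lintegral_prod _ (hF.comp_measurable measurable_circleMap_uncurry)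

lemma integrable_of_continuousOn_of_bound (hω : IsRadialWeight ω) {E : Type*}
    [NormedAddCommGroup E] {F : ℂ → E} (hF : ContinuousOn F (ball 0 1)) (C : ℝ)
    (hC : ∀ z ∈ ball (0 : ℂ) 1, ‖F z‖ ≤ C) : Integrable F (weightMeasure ω) := by
  have := hω.isFiniteMeasure_weightMeasure
  exact .of_bound (aestronglyMeasurable_weightMeasure hF) C ((ae_weightMeasure_mem_ball ω).mono hC)

end IsRadialWeight

section RadialMeasures

/-- The mass `μ (r, ∞)`; for the radial measure of a weight, this is comparable to the tail
integral of the weight when `r` is near `1`. -/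
def tailMass (μ : Measure ℝ) (r : ℝ) : ℝ := μ.real (Ioi r)

/-- The moments of even order, which are the squared norms of the monomials. -/
def evenMoment (μ : Measure ℝ) (n : ℕ) : ℝ := ∫ t, t ^ (2 * n) ∂μ

/-- The finite measures on the radius `(0, 1)` that do not vanish near `1`. -/
structure IsRadialMeasure (μ : Measure ℝ) : Prop where
  finite : IsFiniteMeasure μ
  ae_mem : ∀ᵐ t ∂μ, t ∈ Ioo (0 : ℝ) 1
  tailMass_pos : ∀ r < 1, 0 < tailMass μ r

/-- The upper doubling condition for measures on the radius; the doubling constant is taken to be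
a power of two, whose exponent governs the polynomial growth in the estimates below. -/
structure IsUpperDoublingMeasure (μ : Measure ℝ) : Prop extends IsRadialMeasure μ where
  upper : ∃ p : ℕ, ∀ r ∈ Ico (0 : ℝ) 1, tailMass μ r ≤ 2 ^ p * tailMass μ ((1 + r) / 2)

/-- The lower doubling condition for measures on the radius. The factor `2` is no restriction,
since iterating the condition with the factor `C > 1` replaces `C` and `K` by their powers. -/
structure IsLowerDoublingMeasure (μ : Measure ℝ) (K : ℝ) : Prop extends IsRadialMeasure μ where
  one_lt : 1 < K
  lower : ∀ r ∈ Ico (0 : ℝ) 1, 2 * tailMass μ (1 - (1 - r) / K) ≤ tailMass μ r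

lemma tailMass_nonneg (μ : Measure ℝ) (r : ℝ) : 0 ≤ tailMass μ r := measureReal_nonneg

lemma one_sub_div_mem_Ico {K r : ℝ} (hK : 1 ≤ K) (hr : r ∈ Ico (0 : ℝ) 1) :
    1 - (1 - r) / K ∈ Ico (0 : ℝ) 1 := by
  have hpos : 0 < (1 - r) / K := div_pos (by linarith [hr.2]) (by linarith)
  have hle : (1 - r) / K ≤ 1 - r := div_le_self (by linarith [hr.2]) hK
  exact ⟨by linarith [hr.1], by linarith⟩

lemma pow_mul_le_of_forall_mul_le {R : Type*} [CommSemiring R] [PartialOrder R]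
    [IsOrderedRing R] {f : ℝ → R} {K : ℝ} {C : R} (hK : 1 ≤ K) (hC : 0 ≤ C)
    (hf : ∀ r ∈ Ico (0 : ℝ) 1, C * f (1 - (1 - r) / K) ≤ f r) (j : ℕ) {r : ℝ}
    (hr : r ∈ Ico (0 : ℝ) 1) : C ^ j * f (1 - (1 - r) / K ^ j) ≤ f r := by
  induction j with
  | zero => simp
  | succ j ih =>
    have hiterate : 1 - (1 - (1 - (1 - r) / K ^ j)) / K = 1 - (1 - r) / K ^ (j + 1) := by
      rw [pow_succ]; field_simp; ring
    have hstep := hf _ (one_sub_div_mem_Ico (one_le_pow₀ (n := j) hK) hr)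
    rw [hiterate] at hstep
    rw [pow_succ, mul_assoc]
    exact (mul_le_mul_of_nonneg_left hstep (pow_nonneg hC j)).trans ih

lemma radialMeasure_Ioi (ω : ℂ → ℝ) {r : ℝ} (hr : 0 ≤ r) :
    radialMeasure ω (Ioi r) = ∫⁻ t in Ioo r 1, ENNReal.ofReal (2 * t) * ENNReal.ofReal (ω t) := by
  have hinter : Ioi r ∩ Ioo (0 : ℝ) 1 = Ioo r 1 := by
    ext t; simp only [mem_inter_iff, mem_Ioi, mem_Ioo]; grind
  rw [radialMeasure, withDensity_apply _ measurableSet_Ioi, radiusMeasure,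
    setLIntegral_withDensity_eq_setLIntegral_mul_non_measurable _ (by fun_prop) _ measurableSet_Ioi
      (ae_of_all _ fun _ => ENNReal.ofReal_lt_top), Measure.restrict_restrict measurableSet_Ioi,
    hinter]
  rfl

lemma radialMeasure_Ioi_le (ω : ℂ → ℝ) {r : ℝ} (hr : 0 ≤ r) :
    radialMeasure ω (Ioi r) ≤ 2 * weightTail ω r := by
  rw [radialMeasure_Ioi ω hr, weightTail, ← lintegral_const_mul' _ _ (by simp)]
  refine setLIntegral_mono' measurableSet_Ioo fun t ht => ?_
  gcongr
  exact ENNReal.ofReal_le_of_le_toReal (by simp; linarith [ht.2])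

lemma weightTail_le_radialMeasure_Ioi (ω : ℂ → ℝ) {r : ℝ} (hr : 1 / 2 ≤ r) :
    weightTail ω r ≤ radialMeasure ω (Ioi r) := by
  rw [radialMeasure_Ioi ω (by linarith), weightTail]
  refine setLIntegral_mono' measurableSet_Ioo fun t ht => le_mul_of_one_le_left' ?_
  rw [ENNReal.one_le_ofReal]
  linarith [ht.1]

lemma two_mul_weightTail_le {ω : ℂ → ℝ} {C : ℝ}
    (hC : ∀ r ∈ Ico (0 : ℝ) 1, weightTail ω r ≤ ENNReal.ofReal C * weightTail ω ((1 + r) / 2))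
    {r : ℝ} (hr : r ∈ Ico (0 : ℝ) 1) :
    2 * weightTail ω r ≤ ENNReal.ofReal (2 * C) * radialMeasure ω (Ioi ((1 + r) / 2)) := by
  rw [ENNReal.ofReal_mul zero_le_two, mul_assoc, ENNReal.ofReal_ofNat]
  gcongr
  refine (hC r hr).trans ?_
  gcongr
  exact weightTail_le_radialMeasure_Ioi ω (by linarith [hr.1])

end RadialMeasures

namespace IsRadialWeight

variable {ω : ℂ → ℝ}

lemma isRadialMeasure (hω : IsRadialWeight ω) : IsRadialMeasure (radialMeasure ω) where
  finite := hω.isFiniteMeasure_radialMeasure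
  ae_mem := ae_radialMeasure_mem_Ioo ω
  tailMass_pos r hr := by
    have := hω.isFiniteMeasure_radialMeasure
    set s := max r (1 / 2)
    have hs : s < 1 := max_lt hr (by norm_num)
    have hs' : 1 / 2 ≤ s := le_max_right _ _
    refine ENNReal.toReal_pos (fun hzero => hω.tail_ne_zero s ⟨by linarith, hs⟩ ?_)
      (measure_ne_top _ _)
    refine le_antisymm ((weightTail_le_radialMeasure_Ioi ω hs').trans ?_) zero_le
    exact (measure_mono_null (Ioi_subset_Ioi (le_max_left _ _)) hzero).le

lemma isUpperDoublingMeasure (hω : IsRadialWeight ω) (hup : IsUpperDoubling ω) :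
    IsUpperDoublingMeasure (radialMeasure ω) where
  toIsRadialMeasure := hω.isRadialMeasure
  upper := by
    have := hω.isFiniteMeasure_radialMeasure
    obtain ⟨C, hC0, hC⟩ := hup
    obtain ⟨p, hp⟩ := pow_unbounded_of_one_lt (2 * C) one_lt_two
    refine ⟨p, fun r hr => ?_⟩
    have hdouble : tailMass (radialMeasure ω) r ≤
        2 * C * tailMass (radialMeasure ω) ((1 + r) / 2) := by
      have hle := ENNReal.toReal_mono (by finiteness)
        ((radialMeasure_Ioi_le ω hr.1).trans (two_mul_weightTail_le hC hr))
      rwa [ENNReal.toReal_mul, ENNReal.toReal_ofReal (by positivity)] at hle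
    exact hdouble.trans (mul_le_mul_of_nonneg_right hp.le (tailMass_nonneg _ _))

end IsRadialWeight

lemma IsDoublingWeight.exists_isLowerDoublingMeasure {ω : ℂ → ℝ} (hω : IsDoublingWeight ω) :
    ∃ K, IsLowerDoublingMeasure (radialMeasure ω) K := by
  have hrad := hω.toIsRadialWeight
  have := hrad.isFiniteMeasure_radialMeasure
  obtain ⟨C, hC0, hC⟩ := hω.upper
  obtain ⟨K, C', hK, hC', hlow⟩ := hω.lower
  obtain ⟨j, hj⟩ := pow_unbounded_of_one_lt (4 * C) hC'
  have hKj : 1 < K ^ (j + 1) := one_lt_pow₀ hK j.succ_ne_zero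
  refine ⟨K ^ (j + 1), hrad.isRadialMeasure, hKj, fun r hr => ?_⟩
  have hweight : ENNReal.ofReal C' ^ (j + 1) *
      radialMeasure ω (Ioi (1 - (1 - r) / K ^ (j + 1))) ≤
      ENNReal.ofReal (2 * C) * radialMeasure ω (Ioi r) :=
    calc _ ≤ ENNReal.ofReal C' ^ (j + 1) *
          (2 * weightTail ω (1 - (1 - r) / K ^ (j + 1))) := by
          gcongr; exact radialMeasure_Ioi_le ω (one_sub_div_mem_Ico hKj.le hr).1
      _ = 2 * (ENNReal.ofReal C' ^ (j + 1) * weightTail ω (1 - (1 - r) / K ^ (j + 1))) := by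
          ring
      _ ≤ 2 * weightTail ω r := by
          gcongr; exact pow_mul_le_of_forall_mul_le hK.le zero_le hlow (j + 1) hr
      _ ≤ _ := two_mul_weightTail_le hC hr
      _ ≤ _ := by gcongr; linarith [hr.2]
  have htail : C' ^ (j + 1) * tailMass (radialMeasure ω) (1 - (1 - r) / K ^ (j + 1)) ≤
      2 * C * tailMass (radialMeasure ω) r := by
    have hle := ENNReal.toReal_mono (by finiteness) hweight
    rwa [ENNReal.toReal_mul, ENNReal.toReal_mul, ENNReal.toReal_pow,
      ENNReal.toReal_ofReal (by positivity), ENNReal.toReal_ofReal (by positivity)] at hle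
  have hconst : 4 * C ≤ C' ^ (j + 1) := hj.le.trans (pow_le_pow_right₀ hC'.le j.le_succ)
  have hbound := (mul_le_mul_of_nonneg_right hconst (tailMass_nonneg _ _)).trans htail
  refine le_of_mul_le_mul_left ?_ (show 0 < 2 * C by positivity)
  linarith

/-! ### Moment estimates -/

lemma lintegral_pow_succ_eq_lintegral_meas_lt_mul {α : Type*} [MeasurableSpace α]
    (μ : Measure α) {f : α → ℝ} (hf0 : 0 ≤ᵐ[μ] f) (hf : AEMeasurable f μ) (n : ℕ) :
    ∫⁻ x, ENNReal.ofReal (f x ^ (n + 1)) ∂μ =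
      ENNReal.ofReal (n + 1) * ∫⁻ s in Ioi 0, μ {x | s < f x} * ENNReal.ofReal (s ^ n) := by
  have hcake := lintegral_rpow_eq_lintegral_meas_lt_mul μ hf0 hf (p := n + 1) (by positivity)
  have hpow (y : ℝ) : y ^ ((n : ℝ) + 1) = y ^ (n + 1) := mod_cast Real.rpow_natCast y (n + 1)
  simpa only [hpow, add_sub_cancel_right, Real.rpow_natCast] using hcake

namespace IsRadialMeasure

variable {μ : Measure ℝ}

lemma antitone_tailMass (hμ : IsRadialMeasure μ) : Antitone (tailMass μ) := by
  have := hμ.finite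
  exact fun r s hrs => measureReal_mono (Ioi_subset_Ioi hrs)

lemma integrable_of_bound (hμ : IsRadialMeasure μ) {E : Type*} [NormedAddCommGroup E]
    {f : ℝ → E} (hf : AEStronglyMeasurable f μ) (C : ℝ) (hC : ∀ t ∈ Ioo (0 : ℝ) 1, ‖f t‖ ≤ C) :
    Integrable f μ := by
  have := hμ.finite
  exact .of_bound hf C (hμ.ae_mem.mono hC)

lemma integrable_pow (hμ : IsRadialMeasure μ) (n : ℕ) : Integrable (fun t => t ^ n) μ := by
  refine hμ.integrable_of_bound (by fun_prop) 1 fun t ht => ?_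
  rw [norm_pow, Real.norm_of_nonneg ht.1.le]
  exact pow_le_one₀ ht.1.le ht.2.le

lemma pow_mul_tailMass_le_evenMoment (hμ : IsRadialMeasure μ) {r : ℝ} (hr : 0 ≤ r) (n : ℕ) :
    r ^ (2 * n) * tailMass μ r ≤ evenMoment μ n := by
  have := hμ.finite
  refine le_trans ?_ (mul_meas_ge_le_integral_of_nonneg
    (ae_of_all _ fun t => (even_two_mul n).pow_nonneg t) (hμ.integrable_pow (2 * n)) (r ^ (2 * n)))
  gcongr
  exact measureReal_mono fun t ht => pow_le_pow_left₀ hr (mem_Ioi.1 ht).le _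

lemma evenMoment_pos (hμ : IsRadialMeasure μ) (n : ℕ) : 0 < evenMoment μ n :=
  (mul_pos (by positivity) (hμ.tailMass_pos (1 / 2) (by norm_num))).trans_le
    (hμ.pow_mul_tailMass_le_evenMoment (by norm_num) n)

lemma antitone_evenMoment (hμ : IsRadialMeasure μ) : Antitone (evenMoment μ) := by
  intro m n hmn
  refine integral_mono_ae (hμ.integrable_pow _) (hμ.integrable_pow _) ?_
  filter_upwards [hμ.ae_mem] with t ht
  exact pow_le_pow_of_le_one ht.1.le ht.2.le (by lia)

lemma summable_pow_div_evenMoment (hμ : IsRadialMeasure μ) (k : ℕ) {r : ℝ}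
    (hr : r ∈ Ico (0 : ℝ) 1) : Summable fun n : ℕ => (n : ℝ) ^ k / evenMoment μ n * r ^ n := by
  set ρ := (1 + r) / 2
  have hρ0 : 0 < ρ := by simp only [ρ]; linarith [hr.1]
  have hrρ : r < ρ ^ 2 := by simp only [ρ]; nlinarith [mul_self_pos.2 (sub_pos.2 hr.2).ne']
  have htail := hμ.tailMass_pos ρ (by simp only [ρ]; linarith [hr.2])
  have hratio : ‖r / ρ ^ 2‖ < 1 := by
    rwa [Real.norm_of_nonneg (div_nonneg hr.1 (by positivity)), div_lt_one (by positivity)]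
  refine .of_nonneg_of_le (fun n => ?_) (fun n => ?_)
    ((summable_pow_mul_geometric_of_norm_lt_one k hratio).mul_left (1 / tailMass μ ρ))
  · have := hμ.evenMoment_pos n
    have := hr.1
    positivity
  · calc (n : ℝ) ^ k / evenMoment μ n * r ^ n
        ≤ n ^ k / (ρ ^ (2 * n) * tailMass μ ρ) * r ^ n := by
          have := hr.1
          gcongr
          exact hμ.pow_mul_tailMass_le_evenMoment hρ0.le n
      _ = 1 / tailMass μ ρ * (n ^ k * (r / ρ ^ 2) ^ n) := by
          clear_value ρ
          rw [pow_mul, div_pow]; field_simp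

lemma meas_Ioi_eq_zero (hμ : IsRadialMeasure μ) {s : ℝ} (hs : 1 ≤ s) : μ (Ioi s) = 0 :=
  measure_mono_null (fun _ ht (ht' : _ ∈ Ioo (0 : ℝ) 1) => (hs.trans_lt ht).not_gt ht'.2)
    (ae_iff.1 hμ.ae_mem)

lemma ofReal_evenMoment_succ (hμ : IsRadialMeasure μ) (n : ℕ) :
    ENNReal.ofReal (evenMoment μ (n + 1)) =
      ENNReal.ofReal (2 * n + 2) * ∫⁻ s in Ioi 0, μ (Ioi s) * ENNReal.ofReal (s ^ (2 * n + 1)) := by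
  have hcake := lintegral_pow_succ_eq_lintegral_meas_lt_mul μ
    (hμ.ae_mem.mono fun t ht => ht.1.le) aemeasurable_id' (2 * n + 1)
  rw [evenMoment, ofReal_integral_eq_lintegral_ofReal (hμ.integrable_pow _)
    (ae_of_all _ fun t => (even_two_mul _).pow_nonneg t)]
  convert! hcake using 3
  push_cast
  ring

lemma evenMoment_succ_eq_integral (hμ : IsRadialMeasure μ) (n : ℕ) :
    evenMoment μ (n + 1) =
      ∫ s in Ioo (0 : ℝ) 1, tailMass μ s * ((2 * n + 2) * s ^ (2 * n + 1)) := by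
  have := hμ.finite
  have hintegrand (s : ℝ) : ENNReal.ofReal (tailMass μ s * ((2 * n + 2) * s ^ (2 * n + 1))) =
      ENNReal.ofReal (2 * n + 2) * (μ (Ioi s) * ENNReal.ofReal (s ^ (2 * n + 1))) := by
    rw [ENNReal.ofReal_mul (tailMass_nonneg _ _), ENNReal.ofReal_mul (by positivity), tailMass,
      ofReal_measureReal, mul_left_comm]
  have hsupport : (Ioo (0 : ℝ) 1).indicator (fun s => μ (Ioi s) * ENNReal.ofReal (s ^ (2 * n + 1)))
      = (Ioi (0 : ℝ)).indicator fun s => μ (Ioi s) * ENNReal.ofReal (s ^ (2 * n + 1)) := by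
    ext s
    by_cases hs : s < 1
    · simp [indicator, hs]
    · simp [indicator, hs, hμ.meas_Ioi_eq_zero (not_lt.1 hs)]
  rw [integral_eq_lintegral_of_nonneg_ae, ← ENNReal.toReal_ofReal (hμ.evenMoment_pos _).le,
    hμ.ofReal_evenMoment_succ]
  · simp_rw [hintegrand]
    rw [lintegral_const_mul' _ _ (by simp), ← lintegral_indicator measurableSet_Ioo, hsupport,
      lintegral_indicator measurableSet_Ioi]
  · filter_upwards [ae_restrict_mem measurableSet_Ioo] with s hs
    have := hs.1
    have := tailMass_nonneg μ s
    positivity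
  · exact (hμ.antitone_tailMass.measurable.mul (by fun_prop)).aestronglyMeasurable

end IsRadialMeasure

lemma exists_add_mul_pow_mul_pow_le (q : ℕ) :
    ∃ A > 0, ∀ r : ℝ, 0 ≤ r → r < 1 → ∀ n : ℕ, (2 + 8 * (n * (1 - r))) ^ q * r ^ n ≤ A := by
  refine ⟨8 ^ q * (q.factorial * Real.exp (1 / 4)), by positivity, fun r hr0 hr1 n => ?_⟩
  set y := n * (1 - r)
  have hy : 0 ≤ y := mul_nonneg n.cast_nonneg (by linarith)
  have hpoly : (y + 1 / 4) ^ q ≤ q.factorial * Real.exp (1 / 4) * Real.exp y := by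
    have h := Real.pow_div_factorial_le_exp _ (add_nonneg hy (by norm_num : (0 : ℝ) ≤ 1 / 4)) q
    rw [div_le_iff₀ (by positivity), Real.exp_add] at h
    linarith
  have hgeom : r ^ n ≤ Real.exp (-y) :=
    calc r ^ n ≤ Real.exp (-(1 - r)) ^ n :=
          pow_le_pow_left₀ hr0 (by simpa using Real.one_sub_le_exp_neg (1 - r)) n
      _ = Real.exp (-y) := by rw [← Real.exp_nat_mul]; congr 1; simp only [y]; ring
  calc (2 + 8 * y) ^ q * r ^ n = 8 ^ q * (y + 1 / 4) ^ q * r ^ n := by rw [← mul_pow]; ring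
    _ ≤ 8 ^ q * (q.factorial * Real.exp (1 / 4) * Real.exp y) * Real.exp (-y) := by gcongr
    _ = 8 ^ q * (q.factorial * Real.exp (1 / 4)) * (Real.exp y * Real.exp (-y)) := by ring
    _ = _ := by rw [← Real.exp_add, add_neg_cancel, Real.exp_zero, mul_one]

lemma nat_mul_pow_mul_one_sub_le {u : ℝ} (hu : u ∈ Icc (0 : ℝ) 1) (n : ℕ) :
    n * u ^ n * (1 - u) ≤ 1 := by
  have hsum : n * u ^ n ≤ ∑ i ∈ Finset.range n, u ^ i := by
    simpa using Finset.card_nsmul_le_sum (Finset.range n) (u ^ ·) (u ^ n) fun i hi =>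
      pow_le_pow_of_le_one hu.1 hu.2 (Finset.mem_range.1 hi).le
  calc n * u ^ n * (1 - u) ≤ (∑ i ∈ Finset.range n, u ^ i) * (1 - u) :=
        mul_le_mul_of_nonneg_right hsum (by linarith [hu.2])
    _ = 1 - u ^ n := geom_sum_mul_neg u n
    _ ≤ 1 := by linarith [pow_nonneg hu.1 n]

namespace IsRadialMeasure

variable {μ : Measure ℝ}

lemma meas_Ioi_le_two_pow_mul (hμ : IsRadialMeasure μ) {p : ℕ}
    (hp : ∀ r ∈ Ico (0 : ℝ) 1, tailMass μ r ≤ 2 ^ p * tailMass μ ((1 + r) / 2)) {s : ℝ}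
    (hs : 0 ≤ s) : μ (Ioi s) ≤ 2 ^ p * μ (Ioi ((1 + s) / 2)) := by
  have := hμ.finite
  rcases lt_or_ge s 1 with hs1 | hs1
  · rw [← ofReal_measureReal, ← ofReal_measureReal, ← ENNReal.ofReal_ofNat 2,
      ← ENNReal.ofReal_pow zero_le_two, ← ENNReal.ofReal_mul (by positivity)]
    exact ENNReal.ofReal_le_ofReal (hp s ⟨hs, hs1⟩)
  · simp [hμ.meas_Ioi_eq_zero hs1]

/-- Substituting `s ↦ (1 + s) / 2` in the layer cake formula compares the moments of `t` with
those of `2 * t - 1 ≤ t ^ 2`. -/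
lemma evenMoment_le_two_pow_mul (hμ : IsRadialMeasure μ) {p : ℕ}
    (hp : ∀ r ∈ Ico (0 : ℝ) 1, tailMass μ r ≤ 2 ^ p * tailMass μ ((1 + r) / 2)) (m : ℕ) :
    evenMoment μ m ≤ 2 ^ p * evenMoment μ (2 * m) := by
  rcases m with _ | m
  · exact le_mul_of_one_le_left (hμ.evenMoment_pos 0).le (one_le_pow₀ one_le_two)
  have htail (s : ℝ) (hs : 0 < s) : μ (Ioi s) ≤ 2 ^ p * μ {t | s < max (2 * t - 1) 0} := by
    have hset : {t | s < max (2 * t - 1) 0} = Ioi ((1 + s) / 2) := by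
      ext t; simp only [mem_ofPred_eq, lt_max_iff, hs.not_gt, or_false, mem_Ioi]; grind
    rw [hset]
    exact hμ.meas_Ioi_le_two_pow_mul hp hs.le
  have hcake := lintegral_pow_succ_eq_lintegral_meas_lt_mul μ
    (f := fun t => max (2 * t - 1) 0) (ae_of_all _ fun t => le_max_right _ _) (by fun_prop)
    (2 * m + 1)
  have hle : ENNReal.ofReal (evenMoment μ (m + 1)) ≤
      ENNReal.ofReal (2 ^ p * evenMoment μ (2 * (m + 1))) :=
    calc ENNReal.ofReal (evenMoment μ (m + 1))
        ≤ ENNReal.ofReal (2 * m + 2) * ∫⁻ s in Ioi 0,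
            2 ^ p * (μ {t | s < max (2 * t - 1) 0} * ENNReal.ofReal (s ^ (2 * m + 1))) := by
          rw [hμ.ofReal_evenMoment_succ]
          refine mul_le_mul_right (setLIntegral_mono' measurableSet_Ioi fun s hs => ?_) _
          rw [← mul_assoc]
          gcongr
          exact htail s hs
      _ = 2 ^ p * ∫⁻ t, ENNReal.ofReal (max (2 * t - 1) 0 ^ (2 * m + 1 + 1)) ∂μ := by
          rw [lintegral_const_mul' _ _ (by finiteness), hcake]
          push_cast
          ring_nf
      _ ≤ 2 ^ p * ∫⁻ t, ENNReal.ofReal (t ^ (2 * (2 * (m + 1)))) ∂μ := by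
          refine mul_le_mul_right (lintegral_mono fun t => ENNReal.ofReal_le_ofReal ?_) _
          have hsq : max (2 * t - 1) 0 ≤ t ^ 2 :=
            max_le (by nlinarith [sq_nonneg (t - 1)]) (sq_nonneg t)
          rw [pow_mul t]
          exact pow_le_pow_left₀ (le_max_right _ _) hsq _
      _ = _ := by
          rw [ENNReal.ofReal_mul (by positivity), ENNReal.ofReal_pow zero_le_two,
            ENNReal.ofReal_ofNat, evenMoment, ofReal_integral_eq_lintegral_ofReal
            (hμ.integrable_pow _) (ae_of_all _ fun t => (even_two_mul _).pow_nonneg t)]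
  exact (ENNReal.ofReal_le_ofReal_iff
    (mul_nonneg (by positivity) (hμ.evenMoment_pos _).le)).1 hle

lemma tailMass_le_two_pow_mul {p : ℕ}
    (hp : ∀ r ∈ Ico (0 : ℝ) 1, tailMass μ r ≤ 2 ^ p * tailMass μ ((1 + r) / 2)) (k : ℕ) {r : ℝ}
    (hr : r ∈ Ico (0 : ℝ) 1) : tailMass μ r ≤ (2 ^ k) ^ p * tailMass μ (1 - (1 - r) / 2 ^ k) := by
  have h := pow_mul_le_of_forall_mul_le (f := fun r => -tailMass μ r) (C := 2 ^ p) one_le_two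
    (by positivity) (fun r hr => ?_) k hr
  · rw [← pow_mul, mul_comm k p, pow_mul]
    linarith
  · have := hp r hr
    rw [show 1 - (1 - r) / 2 = (1 + r) / 2 by ring]
    linarith

lemma tailMass_le_evenMoment (hμ : IsRadialMeasure μ) {p : ℕ}
    (hp : ∀ r ∈ Ico (0 : ℝ) 1, tailMass μ r ≤ 2 ^ p * tailMass μ ((1 + r) / 2)) {r : ℝ}
    (hr : r ∈ Ico (0 : ℝ) 1) (n : ℕ) :
    tailMass μ r ≤ 2 * (2 + 8 * (n * (1 - r))) ^ p * evenMoment μ n := by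
  have hy : 0 ≤ n * (1 - r) := mul_nonneg n.cast_nonneg (by linarith [hr.2])
  obtain ⟨k, hk, hk'⟩ := exists_nat_pow_near
    (show 1 ≤ 1 + 4 * (n * (1 - r)) by linarith) (one_lt_two (α := ℝ))
  set s := 1 - (1 - r) / 2 ^ (k + 1) with hs
  have hs0 : 0 ≤ s := (one_sub_div_mem_Ico (one_le_pow₀ one_le_two) hr).1
  have hns : n * (1 - s) ≤ 1 / 4 := by
    rw [hs, sub_sub_cancel, ← mul_div_assoc, div_le_iff₀ (by positivity)]
    linarith
  have hpow : 1 / 2 ≤ s ^ (2 * n) := by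
    have hbernoulli := one_add_mul_le_pow (a := -(1 - s)) (by linarith) (2 * n)
    rw [neg_sub, add_sub_cancel] at hbernoulli
    push_cast at hbernoulli
    linarith
  have hmoment : tailMass μ s ≤ 2 * evenMoment μ n := by
    linarith [mul_le_mul_of_nonneg_right hpow (tailMass_nonneg μ s),
      hμ.pow_mul_tailMass_le_evenMoment hs0 n]
  calc tailMass μ r ≤ (2 ^ (k + 1)) ^ p * tailMass μ s := tailMass_le_two_pow_mul hp (k + 1) hr
    _ ≤ (2 + 8 * (n * (1 - r))) ^ p * (2 * evenMoment μ n) := by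
        gcongr
        · exact tailMass_nonneg μ s
        · rw [pow_succ]; linarith
    _ = _ := by ring

lemma nat_mul_evenMoment_sub_le (hμ : IsRadialMeasure μ) (n : ℕ) :
    n * (evenMoment μ n - evenMoment μ (n + 1)) ≤ 2 * evenMoment μ (n / 2) := by
  simp only [evenMoment]
  rw [← integral_sub (hμ.integrable_pow _) (hμ.integrable_pow _), ← integral_const_mul,
    ← integral_const_mul]
  refine integral_mono_ae (((hμ.integrable_pow _).sub (hμ.integrable_pow _)).const_mul _)
    ((hμ.integrable_pow _).const_mul _) ?_
  filter_upwards [hμ.ae_mem] with t ht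
  have hu : t ^ 2 ∈ Icc (0 : ℝ) 1 := ⟨by positivity, pow_le_one₀ ht.1.le ht.2.le⟩
  obtain ⟨k, hk⟩ : ∃ k, n = n / 2 + k := ⟨n - n / 2, by lia⟩
  have hnk : (n : ℝ) ≤ 2 * k := by exact_mod_cast (by lia : n ≤ 2 * k)
  calc n * (t ^ (2 * n) - t ^ (2 * (n + 1)))
      = n * ((t ^ 2) ^ (n / 2 + k) * (1 - t ^ 2)) := by
        rw [← hk]; ring
    _ ≤ 2 * k * ((t ^ 2) ^ (n / 2 + k) * (1 - t ^ 2)) := by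
        have : 0 ≤ 1 - t ^ 2 := by linarith [hu.2]
        gcongr
    _ = 2 * (t ^ 2) ^ (n / 2) * (k * (t ^ 2) ^ k * (1 - t ^ 2)) := by rw [pow_add]; ring
    _ ≤ 2 * (t ^ 2) ^ (n / 2) * 1 := by gcongr; exact nat_mul_pow_mul_one_sub_le hu k
    _ = 2 * t ^ (2 * (n / 2)) := by rw [← pow_mul, mul_one]

end IsRadialMeasure

namespace IsUpperDoublingMeasure

variable {μ : Measure ℝ}

lemma exists_evenMoment_le (hμ : IsUpperDoublingMeasure μ) :
    ∃ C > 0, ∀ m n : ℕ, n ≤ 2 * m + 1 → evenMoment μ m ≤ C * evenMoment μ n := by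
  obtain ⟨p, hp⟩ := hμ.upper
  have hpos := hμ.evenMoment_pos
  have hdouble := hμ.evenMoment_le_two_pow_mul hp
  refine ⟨2 ^ p * 2 ^ p + evenMoment μ 0 / evenMoment μ 1,
    add_pos (by positivity) (div_pos (hpos 0) (hpos 1)), fun m n hmn => ?_⟩
  have hn := hpos n
  rw [add_mul]
  rcases m.eq_zero_or_pos with rfl | hm
  · refine le_add_of_nonneg_of_le (by positivity) ?_
    rw [div_mul_eq_mul_div, le_div_iff₀ (hpos 1)]
    exact mul_le_mul_of_nonneg_left (hμ.antitone_evenMoment (by lia)) (hpos 0).le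
  · refine le_add_of_le_of_nonneg ?_ (mul_nonneg (div_pos (hpos 0) (hpos 1)).le hn.le)
    calc evenMoment μ m ≤ 2 ^ p * (2 ^ p * evenMoment μ (2 * (2 * m))) :=
          (hdouble m).trans (by gcongr; exact hdouble _)
      _ ≤ 2 ^ p * (2 ^ p * evenMoment μ n) := by
          gcongr; exact hμ.antitone_evenMoment (by lia)
      _ = _ := by ring

lemma exists_abs_sub_div_evenMoment_le (hμ : IsUpperDoublingMeasure μ) :
    ∃ C > 0, ∀ n : ℕ,
      |(n + 1) / evenMoment μ (n + 1) - n / evenMoment μ n| ≤ C / evenMoment μ n := by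
  obtain ⟨C, hC, hmoment⟩ := hμ.exists_evenMoment_le
  refine ⟨C + C * (2 * C), by positivity, fun n => ?_⟩
  have hn := hμ.evenMoment_pos n
  have hn1 := hμ.evenMoment_pos (n + 1)
  have hinv : 1 / evenMoment μ (n + 1) ≤ C / evenMoment μ n := by
    rw [div_le_div_iff₀ hn1 hn, one_mul]
    exact hmoment n (n + 1) (by lia)
  have hdiff : 0 ≤ n * (evenMoment μ n - evenMoment μ (n + 1)) :=
    mul_nonneg n.cast_nonneg (sub_nonneg.2 (hμ.antitone_evenMoment n.le_succ))
  have hdiff_le : n * (evenMoment μ n - evenMoment μ (n + 1)) ≤ 2 * (C * evenMoment μ n) :=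
    (hμ.nat_mul_evenMoment_sub_le n).trans (by gcongr; exact hmoment _ _ (by lia))
  have hsplit : (n + 1) / evenMoment μ (n + 1) - n / evenMoment μ n =
      1 / evenMoment μ (n + 1) + n * (evenMoment μ n - evenMoment μ (n + 1)) /
        (evenMoment μ n * evenMoment μ (n + 1)) := by
    field_simp; ring
  rw [hsplit, abs_of_nonneg (by positivity), add_div]
  refine add_le_add hinv ?_
  calc n * (evenMoment μ n - evenMoment μ (n + 1)) / (evenMoment μ n * evenMoment μ (n + 1))
      ≤ 2 * (C * evenMoment μ n) / (evenMoment μ n * evenMoment μ (n + 1)) := by gcongr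
    _ = 2 * C * (1 / evenMoment μ (n + 1)) := by field_simp
    _ ≤ 2 * C * (C / evenMoment μ n) := by gcongr
    _ = _ := by ring

lemma exists_tsum_div_evenMoment_sq_le (hμ : IsUpperDoublingMeasure μ) :
    ∃ C > 0, ∀ r ∈ Ico (0 : ℝ) 1,
      (Summable fun n : ℕ => r ^ (2 * n) / evenMoment μ n ^ 2) ∧
      ∑' n : ℕ, r ^ (2 * n) / evenMoment μ n ^ 2 ≤ C / ((1 - r) * tailMass μ r ^ 2) := by
  obtain ⟨p, hp⟩ := hμ.upper
  obtain ⟨A, hA, hpow⟩ := exists_add_mul_pow_mul_pow_le (p * 2)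
  refine ⟨4 * A, by positivity, fun r hr => ?_⟩
  have hr0 := hr.1
  have hT := hμ.tailMass_pos r hr.2
  have hterm (n : ℕ) : r ^ (2 * n) / evenMoment μ n ^ 2 ≤ 4 * A / tailMass μ r ^ 2 * r ^ n := by
    have hn := hμ.evenMoment_pos n
    have hT_le := pow_le_pow_left₀ hT.le (hμ.tailMass_le_evenMoment hp hr n) 2
    rw [div_mul_eq_mul_div, div_le_div_iff₀ (by positivity) (by positivity)]
    calc r ^ (2 * n) * tailMass μ r ^ 2
        ≤ r ^ (2 * n) * (2 * (2 + 8 * (n * (1 - r))) ^ p * evenMoment μ n) ^ 2 := by gcongr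
      _ = 4 * ((2 + 8 * (n * (1 - r))) ^ (p * 2) * r ^ n) * r ^ n * evenMoment μ n ^ 2 := by
          rw [two_mul n, pow_add, pow_mul _ p]; ring
      _ ≤ 4 * A * r ^ n * evenMoment μ n ^ 2 := by gcongr; exact hpow r hr.1 hr.2 n
  have hgeom := (summable_geometric_of_lt_one hr.1 hr.2).mul_left (4 * A / tailMass μ r ^ 2)
  have hsum := Summable.of_nonneg_of_le (fun n => by positivity) hterm hgeom
  refine ⟨hsum, (hsum.tsum_le_tsum hterm hgeom).trans_eq ?_⟩
  rw [tsum_mul_left, tsum_geometric_of_lt_one hr.1 hr.2, div_mul_eq_div_div]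
  field_simp

end IsUpperDoublingMeasure

namespace IsRadialMeasure

variable {μ : Measure ℝ}

lemma setLIntegral_Ioc_one_div_tailMass_le (hμ : IsRadialMeasure μ) {p : ℕ}
    (hp : ∀ r ∈ Ico (0 : ℝ) 1, tailMass μ r ≤ 2 ^ p * tailMass μ ((1 + r) / 2)) {r : ℝ}
    (hr : r ∈ Ico (0 : ℝ) 1) :
    ∫⁻ t in Ioc r ((1 + r) / 2), ENNReal.ofReal (1 / ((1 - t) * tailMass μ t)) ∂μ ≤
      ENNReal.ofReal (2 ^ (p + 1) / (1 - r)) := by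
  have := hμ.finite
  have h1r : 0 < 1 - r := by linarith [hr.2]
  have hT := hμ.tailMass_pos ((1 + r) / 2) (by linarith)
  calc ∫⁻ t in Ioc r ((1 + r) / 2), ENNReal.ofReal (1 / ((1 - t) * tailMass μ t)) ∂μ
      ≤ ∫⁻ t in Ioc r ((1 + r) / 2),
          ENNReal.ofReal (1 / ((1 - r) / 2 * tailMass μ ((1 + r) / 2))) ∂μ := by
        refine setLIntegral_mono' measurableSet_Ioc fun t ht => ?_
        have : (1 - r) / 2 ≤ 1 - t := by linarith [ht.2]
        gcongr
        · linarith
        · exact hμ.antitone_tailMass ht.2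
    _ ≤ ENNReal.ofReal (1 / ((1 - r) / 2 * tailMass μ ((1 + r) / 2))) * μ (Ioi r) := by
        rw [setLIntegral_const]; gcongr; exact Ioc_subset_Ioi_self
    _ = ENNReal.ofReal (1 / ((1 - r) / 2 * tailMass μ ((1 + r) / 2)) * tailMass μ r) := by
        rw [ENNReal.ofReal_mul (by positivity), tailMass, tailMass, ofReal_measureReal]
    _ ≤ _ := by
        refine ENNReal.ofReal_le_ofReal ?_
        rw [div_mul_eq_mul_div, one_mul, div_le_div_iff₀ (by positivity) h1r]
        calc tailMass μ r * (1 - r) ≤ 2 ^ p * tailMass μ ((1 + r) / 2) * (1 - r) := by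
              gcongr; exact hp r hr
          _ = _ := by rw [pow_succ]; ring

lemma setLIntegral_Iic_one_div_tailMass_dyadic_le (hμ : IsRadialMeasure μ) {p : ℕ}
    (hp : ∀ r ∈ Ico (0 : ℝ) 1, tailMass μ r ≤ 2 ^ p * tailMass μ ((1 + r) / 2)) (k : ℕ) :
    ∫⁻ t in Iic (1 - (1 / 2) ^ k), ENNReal.ofReal (1 / ((1 - t) * tailMass μ t)) ∂μ ≤
      ENNReal.ofReal (2 ^ (p + 1) * 2 ^ k) := by
  induction k with
  | zero =>
    have hnull : μ (Iic 0) = 0 :=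
      measure_mono_null (fun _ ht (ht' : _ ∈ Ioo (0 : ℝ) 1) => ht'.1.not_ge ht)
        (ae_iff.1 hμ.ae_mem)
    simp [Measure.restrict_eq_zero.2 hnull]
  | succ k ih =>
    set r : ℝ := 1 - (1 / 2) ^ k with hr_def
    have hpow : (1 / 2 : ℝ) ^ k ∈ Ioc 0 1 :=
      ⟨by positivity, pow_le_one₀ (by norm_num) (by norm_num)⟩
    have hr : r ∈ Ico (0 : ℝ) 1 := ⟨by linarith [hpow.2], by linarith [hpow.1]⟩
    rw [show (1 : ℝ) - (1 / 2) ^ (k + 1) = (1 + r) / 2 by rw [hr_def]; ring,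
      ← Iic_union_Ioc_eq_Iic (show r ≤ (1 + r) / 2 by linarith [hr.2]),
      lintegral_union measurableSet_Ioc (Iic_disjoint_Ioc le_rfl)]
    refine (add_le_add ih (hμ.setLIntegral_Ioc_one_div_tailMass_le hp hr)).trans_eq ?_
    rw [hr_def, sub_sub_cancel, one_div_pow, div_div_eq_mul_div, div_one,
      ← ENNReal.ofReal_add (by positivity) (by positivity)]
    ring_nf

lemma setLIntegral_Iic_one_div_tailMass_le (hμ : IsRadialMeasure μ) {p : ℕ}
    (hp : ∀ r ∈ Ico (0 : ℝ) 1, tailMass μ r ≤ 2 ^ p * tailMass μ ((1 + r) / 2)) {r : ℝ}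
    (hr : r ∈ Ico (0 : ℝ) 1) :
    ∫⁻ t in Iic r, ENNReal.ofReal (1 / ((1 - t) * tailMass μ t)) ∂μ ≤
      ENNReal.ofReal (2 ^ (p + 2) / (1 - r)) := by
  have h1r : 0 < 1 - r := by linarith [hr.2]
  obtain ⟨k, hk, hk'⟩ := exists_nat_pow_near
    (show 1 ≤ 1 / (1 - r) by rw [le_div_iff₀ h1r]; linarith [hr.1]) (one_lt_two (α := ℝ))
  have hrk : r ≤ 1 - (1 / 2) ^ (k + 1) := by
    rw [one_div_pow, le_sub_comm, one_div_le (by positivity) h1r]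
    exact hk'.le
  calc ∫⁻ t in Iic r, ENNReal.ofReal (1 / ((1 - t) * tailMass μ t)) ∂μ
      ≤ ∫⁻ t in Iic (1 - (1 / 2) ^ (k + 1)), ENNReal.ofReal (1 / ((1 - t) * tailMass μ t)) ∂μ :=
        lintegral_mono_set (Iic_subset_Iic.2 hrk)
    _ ≤ ENNReal.ofReal (2 ^ (p + 1) * 2 ^ (k + 1)) :=
        hμ.setLIntegral_Iic_one_div_tailMass_dyadic_le hp (k + 1)
    _ = ENNReal.ofReal (2 ^ (p + 2) * 2 ^ k) := by ring_nf
    _ ≤ ENNReal.ofReal (2 ^ (p + 2) * (1 / (1 - r))) := by gcongr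
    _ = _ := by rw [mul_one_div]

end IsRadialMeasure

lemma IsUpperDoublingMeasure.exists_lintegral_one_div_tailMass_le {μ : Measure ℝ}
    (hμ : IsUpperDoublingMeasure μ) :
    ∃ A > 0, ∀ r ∈ Ico (0 : ℝ) 1,
      ∫⁻ t, ENNReal.ofReal (1 / ((1 - r * t) * tailMass μ (r * t))) ∂μ ≤
        ENNReal.ofReal (A / (1 - r)) := by
  have := hμ.finite
  obtain ⟨p, hp⟩ := hμ.upper
  refine ⟨2 ^ (p + 2) + 1, by positivity, fun r hr => ?_⟩
  have h1r : 0 < 1 - r := by linarith [hr.2]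
  have hT := hμ.tailMass_pos r hr.2
  rw [← lintegral_add_compl _ (measurableSet_Iic (a := r)), compl_Iic, add_div,
    ENNReal.ofReal_add (by positivity) (by positivity)]
  refine add_le_add (le_trans ?_ (hμ.setLIntegral_Iic_one_div_tailMass_le hp hr)) ?_
  · refine lintegral_mono_ae ?_
    filter_upwards [ae_restrict_of_ae hμ.ae_mem] with t ht
    have hrt : r * t ≤ t := mul_le_of_le_one_left ht.1.le hr.2.le
    have := hμ.tailMass_pos t ht.2
    have : 0 < 1 - t := by linarith [ht.2]
    gcongr
    · linarith
    · exact hμ.antitone_tailMass hrt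
  · calc ∫⁻ t in Ioi r, ENNReal.ofReal (1 / ((1 - r * t) * tailMass μ (r * t))) ∂μ
        ≤ ∫⁻ t in Ioi r, ENNReal.ofReal (1 / ((1 - r) * tailMass μ r)) ∂μ := by
          refine lintegral_mono_ae ?_
          filter_upwards [ae_restrict_of_ae hμ.ae_mem] with t ht
          have hrt : r * t ≤ r := mul_le_of_le_one_right hr.1 ht.2.le
          gcongr
          · linarith
          · exact hμ.antitone_tailMass hrt
      _ = ENNReal.ofReal (1 / ((1 - r) * tailMass μ r) * tailMass μ r) := by
          rw [setLIntegral_const, ENNReal.ofReal_mul (by positivity)]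
          congr 1
          rw [tailMass, ofReal_measureReal]
      _ = _ := by
          congr 1
          field_simp

/-! ### The Bergman kernel -/

section PowerSeries

lemma norm_mul_pow_le {c w : ℂ} {r : ℝ} (hw : w ∈ ball (0 : ℂ) r) (n : ℕ) :
    ‖c * w ^ n‖ ≤ ‖c‖ * r ^ n := by
  rw [norm_mul, norm_pow]
  gcongr
  exact (mem_ball_zero_iff.1 hw).le

variable {a : ℕ → ℂ}

lemma differentiableOn_powerSeries (ha : ∀ r ∈ Ico (0 : ℝ) 1, Summable fun n => ‖a n‖ * r ^ n) :
    DifferentiableOn ℂ (fun z => ∑' n, a n * z ^ n) (ball 0 1) := by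
  intro z hz
  obtain ⟨r, hzr, hr⟩ := exists_between (mem_ball_zero_iff.1 hz)
  have hdiff : DifferentiableOn ℂ (fun z => ∑' n, a n * z ^ n) (ball 0 r) :=
    Complex.differentiableOn_tsum_of_summable_norm (ha r ⟨(norm_nonneg z).trans hzr.le, hr⟩)
      (fun n => by fun_prop) isOpen_ball fun n w hw => norm_mul_pow_le hw n
  exact (hdiff.differentiableAt
    (isOpen_ball.mem_nhds (mem_ball_zero_iff.2 hzr))).differentiableWithinAt

lemma hasSum_deriv_powerSeries
    (ha : ∀ r ∈ Ico (0 : ℝ) 1, Summable fun n => ‖a n‖ * r ^ n) {z : ℂ} (hz : z ∈ ball (0 : ℂ) 1) :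
    HasSum (fun n : ℕ => (n + 1) * a (n + 1) * z ^ n) (deriv (fun z => ∑' n, a n * z ^ n) z) := by
  obtain ⟨r, hzr, hr⟩ := exists_between (mem_ball_zero_iff.1 hz)
  have h := Complex.hasSum_deriv_of_summable_norm (F := fun n (z : ℂ) => a n * z ^ n)
    (ha r ⟨(norm_nonneg z).trans hzr.le, hr⟩) (fun n => by fun_prop) isOpen_ball
    (fun n w hw => norm_mul_pow_le hw n) (mem_ball_zero_iff.2 hzr)
  rw [← hasSum_nat_add_iff' 1] at h
  convert! h using 1
  · ext n
    simp
    ring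
  · simp

/-- The Taylor coefficients at the origin. -/
def taylorCoeff (f : ℂ → ℂ) (n : ℕ) : ℂ := (n.factorial : ℂ)⁻¹ * iteratedDeriv n f 0

variable {f : ℂ → ℂ}

lemma hasSum_taylorCoeff (hf : DifferentiableOn ℂ f (ball 0 1)) {z : ℂ}
    (hz : z ∈ ball (0 : ℂ) 1) : HasSum (fun n => taylorCoeff f n * z ^ n) (f z) := by
  convert! Complex.hasSum_taylorSeries_on_ball hf hz using 2 with n
  rw [taylorCoeff, sub_zero, smul_eq_mul, smul_eq_mul]
  ring

lemma summable_norm_taylorCoeff (hf : DifferentiableOn ℂ f (ball 0 1)) {r : ℝ}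
    (hr : r ∈ Ico (0 : ℝ) 1) : Summable fun n => ‖taylorCoeff f n‖ * r ^ n := by
  have hrz : (r : ℂ) ∈ ball (0 : ℂ) 1 := by simpa [abs_of_nonneg hr.1] using hr.2
  simpa [abs_of_nonneg hr.1] using (hasSum_taylorCoeff hf hrz).summable.norm

lemma taylorCoeff_deriv (f : ℂ → ℂ) (n : ℕ) :
    taylorCoeff (deriv f) n = (n + 1) * taylorCoeff f (n + 1) := by
  have : (n : ℂ) + 1 ≠ 0 := by exact_mod_cast n.succ_ne_zero
  rw [taylorCoeff, taylorCoeff, iteratedDeriv_succ', Nat.factorial_succ]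
  push_cast
  field_simp

end PowerSeries

/-- The power series with the inverse moments as coefficients: `B_z^ω(ξ)` is its value at
`conj z * ξ`. -/
def kernelSeries (μ : Measure ℝ) (w : ℂ) : ℂ := ∑' n, ((evenMoment μ n)⁻¹ : ℂ) * w ^ n

lemma conj_kernelSeries (μ : Measure ℝ) (z ξ : ℂ) :
    conj (kernelSeries μ (conj z * ξ)) = ∑' n, ((evenMoment μ n)⁻¹ : ℂ) * (z * conj ξ) ^ n := by
  simp [kernelSeries, Complex.conj_tsum]

namespace IsRadialMeasure

variable {μ : Measure ℝ}

lemma norm_inv_evenMoment (hμ : IsRadialMeasure μ) (n : ℕ) :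
    ‖((evenMoment μ n)⁻¹ : ℂ)‖ = (evenMoment μ n)⁻¹ := by
  rw [norm_inv, Complex.norm_of_nonneg (hμ.evenMoment_pos n).le]

lemma summable_norm_inv_evenMoment (hμ : IsRadialMeasure μ) {r : ℝ} (hr : r ∈ Ico (0 : ℝ) 1) :
    Summable fun n => ‖((evenMoment μ n)⁻¹ : ℂ)‖ * r ^ n := by
  simpa [hμ.norm_inv_evenMoment] using hμ.summable_pow_div_evenMoment 0 hr

lemma differentiableOn_kernelSeries (hμ : IsRadialMeasure μ) :
    DifferentiableOn ℂ (kernelSeries μ) (ball 0 1) :=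
  differentiableOn_powerSeries fun _ hr => hμ.summable_norm_inv_evenMoment hr

lemma norm_kernelSeries_le (hμ : IsRadialMeasure μ) {r : ℝ} (hr : r ∈ Ico (0 : ℝ) 1) {w : ℂ}
    (hw : ‖w‖ ≤ r) : ‖kernelSeries μ w‖ ≤ ∑' n, ‖((evenMoment μ n)⁻¹ : ℂ)‖ * r ^ n :=
  tsum_of_norm_bounded (hμ.summable_norm_inv_evenMoment hr).hasSum fun n => by
    rw [norm_mul, norm_pow]; gcongr

end IsRadialMeasure

lemma integrable_mul_conj_pow {ω : ℂ → ℝ} {Φ : ℂ → ℂ} (hΦ : Integrable Φ (weightMeasure ω))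
    (n : ℕ) : Integrable (fun ξ => Φ ξ * conj ξ ^ n) (weightMeasure ω) := by
  have hcont : Continuous fun ξ : ℂ => conj ξ ^ n := by fun_prop
  refine hΦ.mul_bdd (c := 1) hcont.aestronglyMeasurable ?_
  filter_upwards [ae_weightMeasure_mem_ball ω] with ξ hξ
  rw [norm_pow, RCLike.norm_conj]
  exact pow_le_one₀ (norm_nonneg _) (mem_ball_zero_iff.1 hξ).le

lemma mapsTo_conj_mul_ball {z : ℂ} (hz : z ∈ ball (0 : ℂ) 1) :
    MapsTo (conj z * ·) (ball (0 : ℂ) 1) (ball 0 1) := fun ξ hξ => by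
  rw [mem_ball_zero_iff] at *
  rw [norm_mul, RCLike.norm_conj]
  exact mul_lt_one_of_nonneg_of_lt_one_left (norm_nonneg _) hz hξ.le

lemma integrable_mul_conj {μ : Measure ℂ} {f g : ℂ → ℂ} (hf : MemLp f 2 μ) (hg : MemLp g 2 μ) :
    Integrable (fun ξ => f ξ * conj (g ξ)) μ :=
  hf.integrable_mul hg.star

lemma hasSum_integral_mul_tsum_mul_conj_pow {ω : ℂ → ℝ} {F : ℂ → ℂ}
    (hF : Integrable F (weightMeasure ω)) {a : ℕ → ℂ} {z : ℂ}
    (ha : Summable fun n => ‖a n‖ * ‖z‖ ^ n) :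
    HasSum (fun n => a n * (∫ ξ, F ξ * conj ξ ^ n ∂weightMeasure ω) * z ^ n)
      (∫ ξ, F ξ * ∑' n, a n * (z * conj ξ) ^ n ∂weightMeasure ω) := by
  have hcont : Continuous fun ξ : ℂ => z * conj ξ := by fun_prop
  simp_rw [mul_assoc, ← integral_mul_const, mul_assoc, mul_comm _ (z ^ _), ← mul_pow]
  refine hasSum_integral_mul_powerSeries hF hcont.aestronglyMeasurable ?_ ha
  filter_upwards [ae_weightMeasure_mem_ball ω] with ξ hξ
  rw [norm_mul, RCLike.norm_conj]
  exact mul_le_of_le_one_right (norm_nonneg _) (mem_ball_zero_iff.1 hξ).le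

namespace IsRadialWeight

variable {ω : ℂ → ℝ} {z : ℂ}

lemma differentiableOn_kernel (hω : IsRadialWeight ω) (hz : z ∈ ball (0 : ℂ) 1) :
    DifferentiableOn ℂ (fun ξ => kernelSeries (radialMeasure ω) (conj z * ξ)) (ball 0 1) :=
  hω.isRadialMeasure.differentiableOn_kernelSeries.comp (by fun_prop) (mapsTo_conj_mul_ball hz)

lemma exists_norm_kernel_le (hω : IsRadialWeight ω) (hz : z ∈ ball (0 : ℂ) 1) :
    ∃ C : ℝ, ∀ ξ ∈ ball (0 : ℂ) 1, ‖kernelSeries (radialMeasure ω) (conj z * ξ)‖ ≤ C := by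
  refine ⟨_, fun ξ hξ => hω.isRadialMeasure.norm_kernelSeries_le
    ⟨norm_nonneg z, mem_ball_zero_iff.1 hz⟩ ?_⟩
  rw [norm_mul, RCLike.norm_conj]
  exact mul_le_of_le_one_right (norm_nonneg _) (mem_ball_zero_iff.1 hξ).le

lemma integral_powerSeries_mul_conj_pow (hω : IsRadialWeight ω) {f : ℂ → ℂ}
    (hf : Integrable f (weightMeasure ω)) {a : ℝ → ℕ → ℂ}
    (ha : ∀ t ∈ Ioo (0 : ℝ) 1, Summable fun n => ‖a t n‖ * t ^ n)
    (hfa : ∀ t ∈ Ioo (0 : ℝ) 1, ∀ θ, f (circleMap 0 t θ) = ∑' n, a t n * circleMap 0 t θ ^ n)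
    (n : ℕ) :
    ∫ ξ, f ξ * conj ξ ^ n ∂weightMeasure ω = ∫ t, a t n * (t : ℂ) ^ (2 * n) ∂radialMeasure ω := by
  rw [hω.integral_weightMeasure_circleMap (integrable_mul_conj_pow hf n)]
  refine integral_congr_ae ?_
  filter_upwards [ae_radialMeasure_mem_Ioo ω] with t ht
  simp_rw [hfa t ht]
  exact integral_tsum_circleMap_mul_conj_pow ht.1.le (ha t ht) n

lemma integral_mul_conj_pow (hω : IsRadialWeight ω) {f : ℂ → ℂ}
    (hf : Integrable f (weightMeasure ω)) (hd : DifferentiableOn ℂ f (ball 0 1)) (n : ℕ) :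
    ∫ ξ, f ξ * conj ξ ^ n ∂weightMeasure ω =
      taylorCoeff f n * evenMoment (radialMeasure ω) n := by
  rw [hω.integral_powerSeries_mul_conj_pow hf (a := fun _ => taylorCoeff f)
    (fun t ht => summable_norm_taylorCoeff hd ⟨ht.1.le, ht.2⟩) (fun t ht θ => ?_) n]
  · rw [integral_const_mul, evenMoment, ← integral_complex_ofReal]
    push_cast
    rfl
  · exact (hasSum_taylorCoeff hd (by simpa [abs_of_pos ht.1] using ht.2)).tsum_eq.symm

lemma hasSum_integral_mul_kernel (hω : IsRadialWeight ω) {F : ℂ → ℂ}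
    (hF : Integrable F (weightMeasure ω)) (hz : z ∈ ball (0 : ℂ) 1) :
    HasSum (fun n => ((evenMoment (radialMeasure ω) n)⁻¹ : ℂ) *
        (∫ ξ, F ξ * conj ξ ^ n ∂weightMeasure ω) * z ^ n)
      (∫ ξ, F ξ * conj (kernelSeries (radialMeasure ω) (conj z * ξ)) ∂weightMeasure ω) := by
  simp_rw [conj_kernelSeries]
  exact hasSum_integral_mul_tsum_mul_conj_pow hF
    (hω.isRadialMeasure.summable_norm_inv_evenMoment ⟨norm_nonneg z, mem_ball_zero_iff.1 hz⟩)

lemma memBergmanTwo_iff (hω : IsRadialWeight ω) {f : ℂ → ℂ} :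
    MemBergmanTwo ω f ↔ DifferentiableOn ℂ f (ball 0 1) ∧ MemLp f 2 (weightMeasure ω) := by
  refine and_congr_right fun hf => ?_
  rw [memLp_two_iff_integrable_sq_norm (aestronglyMeasurable_weightMeasure hf.continuousOn),
    hω.integrable_weightMeasure_iff]
  simp only [smul_eq_mul, mul_comm]

lemma isReproducingKernelAt_iff (hω : IsRadialWeight ω) {k : ℂ → ℂ} :
    IsReproducingKernelAt ω z k ↔ MemBergmanTwo ω k ∧ ∀ f, MemBergmanTwo ω f →
      f z = ∫ ξ, f ξ * conj (k ξ) ∂weightMeasure ω := by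
  simp only [IsReproducingKernelAt, hω.integral_weightMeasure, Complex.real_smul, mul_comm]

lemma ae_eq_of_isReproducingKernelAt (hω : IsRadialWeight ω) {k l : ℂ → ℂ}
    (hk : IsReproducingKernelAt ω z k) (hl : IsReproducingKernelAt ω z l) :
    k =ᵐ[weightMeasure ω] l := by
  rw [hω.isReproducingKernelAt_iff] at hk hl
  have hkL := (hω.memBergmanTwo_iff.1 hk.1).2
  have hlL := (hω.memBergmanTwo_iff.1 hl.1).2
  have hdL := hkL.sub hlL
  have hd : MemBergmanTwo ω (k - l) := hω.memBergmanTwo_iff.2 ⟨hk.1.1.sub hl.1.1, hdL⟩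
  have hsq (ξ : ℂ) : ((‖(k - l) ξ‖ ^ 2 : ℝ) : ℂ) =
      (k - l) ξ * conj (k ξ) - (k - l) ξ * conj (l ξ) := by
    rw [← mul_sub, ← map_sub, ← Pi.sub_apply, Complex.mul_conj', Complex.ofReal_pow]
  have hzero : ∫ ξ, ((‖(k - l) ξ‖ ^ 2 : ℝ) : ℂ) ∂weightMeasure ω = 0 := by
    simp_rw [hsq]
    rw [integral_sub (integrable_mul_conj hdL hkL) (integrable_mul_conj hdL hlL), ← hk.2 _ hd,
      ← hl.2 _ hd, sub_self]
  rw [integral_complex_ofReal, Complex.ofReal_eq_zero,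
    integral_eq_zero_iff_of_nonneg (fun ξ => sq_nonneg _)
      ((memLp_two_iff_integrable_sq_norm hdL.1).1 hdL)] at hzero
  filter_upwards [hzero] with ξ hξ
  simpa [sub_eq_zero] using hξ

theorem isReproducingKernelAt_kernelSeries (hω : IsRadialWeight ω) (hz : z ∈ ball (0 : ℂ) 1) :
    IsReproducingKernelAt ω z fun ξ => kernelSeries (radialMeasure ω) (conj z * ξ) := by
  have := hω.isFiniteMeasure_weightMeasure
  have hd := hω.differentiableOn_kernel hz
  rw [hω.isReproducingKernelAt_iff, hω.memBergmanTwo_iff]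
  refine ⟨⟨hd, ?_⟩, fun f hf => ?_⟩
  · obtain ⟨C, hC⟩ := hω.exists_norm_kernel_le hz
    exact .of_bound (aestronglyMeasurable_weightMeasure hd.continuousOn) C
      ((ae_weightMeasure_mem_ball ω).mono hC)
  · have hfint := (hω.memBergmanTwo_iff.1 hf).2.integrable one_le_two
    refine (hasSum_taylorCoeff hf.1 hz).unique ?_
    convert! hω.hasSum_integral_mul_kernel hfint hz using 3 with n
    have : (evenMoment (radialMeasure ω) n : ℂ) ≠ 0 := by
      exact_mod_cast (hω.isRadialMeasure.evenMoment_pos n).ne'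
    rw [hω.integral_mul_conj_pow hfint hf.1]
    field_simp

theorem isReproducingKernelAt_bergmanKernel (hω : IsRadialWeight ω) (hz : z ∈ ball (0 : ℂ) 1) :
    IsReproducingKernelAt ω z (bergmanKernel ω z) := by
  have h : ∃ k, IsReproducingKernelAt ω z k := ⟨_, hω.isReproducingKernelAt_kernelSeries hz⟩
  rw [bergmanKernel, dif_pos h]
  exact h.choose_spec

lemma bergmanKernel_ae_eq (hω : IsRadialWeight ω) (hz : z ∈ ball (0 : ℂ) 1) :
    bergmanKernel ω z =ᵐ[weightMeasure ω] fun ξ => kernelSeries (radialMeasure ω) (conj z * ξ) :=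
  hω.ae_eq_of_isReproducingKernelAt (hω.isReproducingKernelAt_bergmanKernel hz)
    (hω.isReproducingKernelAt_kernelSeries hz)

end IsRadialWeight

lemma bergmanIntegrand_eq_smul (ω : ℂ → ℝ) (Φ : ℂ → ℂ) (z : ℂ) :
    bergmanIntegrand ω Φ z = fun ξ => ω ξ • (Φ ξ * conj (bergmanKernel ω z ξ)) := by
  ext ξ
  rw [bergmanIntegrand, Complex.real_smul]
  ring

/-- The Taylor coefficients of the Bergman projection of `Φ`. -/
def projCoeff (ω : ℂ → ℝ) (Φ : ℂ → ℂ) (n : ℕ) : ℂ :=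
  ((evenMoment (radialMeasure ω) n)⁻¹ : ℂ) * ∫ ξ, Φ ξ * conj ξ ^ n ∂weightMeasure ω

namespace IsRadialWeight

variable {ω : ℂ → ℝ} {Φ : ℂ → ℂ} {z : ℂ}

theorem integrable_bergmanIntegrand (hω : IsRadialWeight ω) (hΦ : Integrable Φ (weightMeasure ω))
    (hz : z ∈ ball (0 : ℂ) 1) : Integrable (bergmanIntegrand ω Φ z) diskArea := by
  rw [bergmanIntegrand_eq_smul, ← hω.integrable_weightMeasure_iff]
  obtain ⟨C, hC⟩ := hω.exists_norm_kernel_le hz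
  have hkernel := aestronglyMeasurable_weightMeasure (ω := ω)
    (hω.differentiableOn_kernel hz).continuousOn.star
  refine (hΦ.mul_bdd (c := C) hkernel ?_).congr ?_
  · filter_upwards [ae_weightMeasure_mem_ball ω] with ξ hξ
    rw [norm_star]
    exact hC ξ hξ
  · filter_upwards [hω.bergmanKernel_ae_eq hz] with ξ hξ
    rw [hξ]
    rfl

theorem hasSum_bergmanProjection (hω : IsRadialWeight ω) (hΦ : Integrable Φ (weightMeasure ω))
    (hz : z ∈ ball (0 : ℂ) 1) :
    HasSum (fun n => projCoeff ω Φ n * z ^ n) (bergmanProjection ω Φ z) := by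
  convert! hω.hasSum_integral_mul_kernel hΦ hz using 1
  rw [bergmanProjection, bergmanIntegrand_eq_smul, ← hω.integral_weightMeasure]
  refine integral_congr_ae ?_
  filter_upwards [hω.bergmanKernel_ae_eq hz] with ξ hξ
  rw [hξ]

end IsRadialWeight

/-! ### The derivative of the kernel and the Bloch bound -/

/-- The Taylor coefficients of the derivative of `kernelSeries μ`. -/
def derivCoeff (μ : Measure ℝ) (n : ℕ) : ℂ := (((n + 1) / evenMoment μ (n + 1) : ℝ) : ℂ)

/-- The Taylor coefficients of `(1 - w)` times the derivative of `kernelSeries μ`. -/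
def derivDiffCoeff (μ : Measure ℝ) (n : ℕ) : ℂ :=
  (((n + 1) / evenMoment μ (n + 1) - n / evenMoment μ n : ℝ) : ℂ)

section CircleMeans

variable {a : ℕ → ℂ} {z : ℂ} {t : ℝ}

lemma summable_norm_mul_pow (ha : Summable fun n => ‖a n‖ * (‖z‖ * t) ^ n) :
    Summable fun n => ‖a n * z ^ n‖ * t ^ n :=
  ha.congr fun n => by rw [norm_mul, norm_pow, mul_pow, mul_assoc]

lemma continuous_tsum_mul_circleMap (ht : 0 ≤ t)
    (ha : Summable fun n => ‖a n‖ * (‖z‖ * t) ^ n) :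
    Continuous fun θ => ∑' n, a n * (z * circleMap 0 t θ) ^ n := by
  simpa only [mul_pow, mul_assoc] using
    continuous_tsum_mul_circleMap_pow ht (summable_norm_mul_pow ha)

lemma integral_norm_sq_tsum_mul_circleMap (ht : 0 ≤ t)
    (ha : Summable fun n => ‖a n‖ * (‖z‖ * t) ^ n) :
    ∫ θ, ‖∑' n, a n * (z * circleMap 0 t θ) ^ n‖ ^ 2 ∂angleMeasure =
      ∑' n, ‖a n‖ ^ 2 * (‖z‖ * t) ^ (2 * n) := by
  simpa only [mul_pow, mul_assoc, norm_mul, norm_pow, ← pow_mul, mul_comm 2] using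
    integral_norm_sq_tsum_circleMap ht (summable_norm_mul_pow ha)

lemma integral_norm_sq_geometric_circleMap_le (ht : 0 ≤ t) (hzt : ‖z‖ * t < 1) :
    ∫ θ, ‖∑' n, (z * circleMap 0 t θ) ^ n‖ ^ 2 ∂angleMeasure ≤ 1 / (1 - ‖z‖ * t) := by
  have hρ : 0 ≤ ‖z‖ * t := by positivity
  have h := integral_norm_sq_tsum_mul_circleMap (a := 1) ht
    (by simpa using summable_geometric_of_lt_one hρ hzt)
  simp only [Pi.one_apply, one_mul, norm_one, one_pow, pow_mul] at h
  rw [h, tsum_geometric_of_lt_one (by positivity) (by nlinarith), inv_eq_one_div]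
  gcongr
  nlinarith

end CircleMeans

namespace IsRadialMeasure

variable {μ : Measure ℝ}

lemma norm_derivCoeff (hμ : IsRadialMeasure μ) (n : ℕ) :
    ‖derivCoeff μ n‖ = (n + 1) / evenMoment μ (n + 1) := by
  have := hμ.evenMoment_pos (n + 1)
  rw [derivCoeff, Complex.norm_of_nonneg (by positivity)]

lemma summable_norm_derivCoeff (hμ : IsRadialMeasure μ) {r : ℝ} (hr : r ∈ Ico (0 : ℝ) 1) :
    Summable fun n => ‖derivCoeff μ n‖ * r ^ n := by
  obtain ⟨s, hrs, hs⟩ := exists_between hr.2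
  have hs0 : 0 < s := hr.1.trans_lt hrs
  refine (((summable_nat_add_iff 1).2
    (hμ.summable_pow_div_evenMoment 1 ⟨hs0.le, hs⟩)).mul_left s⁻¹).of_nonneg_of_le
    (fun n => mul_nonneg (norm_nonneg _) (pow_nonneg hr.1 n)) fun n => ?_
  have hm := hμ.evenMoment_pos (n + 1)
  have hrn := pow_le_pow_left₀ hr.1 hrs.le n
  calc ‖derivCoeff μ n‖ * r ^ n ≤ (n + 1) / evenMoment μ (n + 1) * s ^ n := by
        rw [hμ.norm_derivCoeff]; gcongr
    _ = _ := by push_cast; field_simp; ring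

lemma one_sub_mul_tsum_derivCoeff (hμ : IsRadialMeasure μ) {w : ℂ} (hw : ‖w‖ < 1) :
    (1 - w) * ∑' n, derivCoeff μ n * w ^ n = ∑' n, derivDiffCoeff μ n * w ^ n := by
  have hsum : Summable fun n => derivCoeff μ n * w ^ n :=
    .of_norm (by simpa using hμ.summable_norm_derivCoeff ⟨norm_nonneg w, hw⟩)
  have hshift : HasSum (fun n : ℕ => ((n / evenMoment μ n : ℝ) : ℂ) * w ^ n)
      (w * ∑' n, derivCoeff μ n * w ^ n) := by
    rw [← hasSum_nat_add_iff' 1]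
    convert! hsum.hasSum.mul_left w using 1
    · ext n
      rw [derivCoeff]
      push_cast
      ring
    · simp
  rw [sub_mul, one_mul, ← (hsum.hasSum.sub hshift).tsum_eq]
  refine tsum_congr fun n => ?_
  rw [derivCoeff, derivDiffCoeff]
  push_cast
  ring

lemma norm_tsum_derivCoeff_le (hμ : IsRadialMeasure μ) {w : ℂ} (hw : ‖w‖ < 1) {T : ℝ}
    (hT : 0 < T) :
    ‖∑' n, derivCoeff μ n * w ^ n‖ ≤
      T * ‖∑' n, derivDiffCoeff μ n * w ^ n‖ ^ 2 + T⁻¹ * ‖∑' n, w ^ n‖ ^ 2 := by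
  have hw1 : 1 - w ≠ 0 := sub_ne_zero.2 fun h => by simp [← h] at hw
  have hfactor : ∑' n, derivCoeff μ n * w ^ n =
      (∑' n, derivDiffCoeff μ n * w ^ n) * ∑' n, w ^ n := by
    rw [tsum_geometric_of_norm_lt_one hw, ← hμ.one_sub_mul_tsum_derivCoeff hw]
    field_simp
  rw [hfactor, norm_mul]
  set x := ‖∑' n, derivDiffCoeff μ n * w ^ n‖
  set y := ‖∑' n, w ^ n‖
  have hsq : T * x ^ 2 + T⁻¹ * y ^ 2 = T⁻¹ * (T * x - y) ^ 2 + 2 * (x * y) := by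
    field_simp
    ring
  have hxy : 0 ≤ x * y := by positivity
  have hnonneg : 0 ≤ T⁻¹ * (T * x - y) ^ 2 := by positivity
  linarith

end IsRadialMeasure

namespace IsUpperDoublingMeasure

variable {μ : Measure ℝ}

lemma exists_norm_derivDiffCoeff_le (hμ : IsUpperDoublingMeasure μ) :
    ∃ C > 0, ∀ n, ‖derivDiffCoeff μ n‖ ≤ C / evenMoment μ n := by
  simpa only [derivDiffCoeff, Complex.norm_real, Real.norm_eq_abs] using
    hμ.exists_abs_sub_div_evenMoment_le

lemma summable_norm_derivDiffCoeff (hμ : IsUpperDoublingMeasure μ) {r : ℝ}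
    (hr : r ∈ Ico (0 : ℝ) 1) : Summable fun n => ‖derivDiffCoeff μ n‖ * r ^ n := by
  obtain ⟨C, -, hC⟩ := hμ.exists_norm_derivDiffCoeff_le
  refine ((hμ.summable_pow_div_evenMoment 0 hr).mul_left C).of_nonneg_of_le
    (fun n => mul_nonneg (norm_nonneg _) (pow_nonneg hr.1 n)) fun n => ?_
  rw [pow_zero, ← mul_assoc, mul_one_div]
  exact mul_le_mul_of_nonneg_right (hC n) (pow_nonneg hr.1 n)

lemma exists_integral_norm_sq_derivDiffCoeff_le (hμ : IsUpperDoublingMeasure μ) :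
    ∃ C > 0, ∀ z : ℂ, ∀ t : ℝ, 0 ≤ t → ‖z‖ * t < 1 →
      ∫ θ, ‖∑' n, derivDiffCoeff μ n * (z * circleMap 0 t θ) ^ n‖ ^ 2 ∂angleMeasure ≤
        C / ((1 - ‖z‖ * t) * tailMass μ (‖z‖ * t) ^ 2) := by
  obtain ⟨C₁, hC₁, hcoeff⟩ := hμ.exists_norm_derivDiffCoeff_le
  obtain ⟨C₂, hC₂, hmoment⟩ := hμ.exists_tsum_div_evenMoment_sq_le
  refine ⟨C₁ ^ 2 * C₂, by positivity, fun z t ht hzt => ?_⟩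
  have hρ : ‖z‖ * t ∈ Ico (0 : ℝ) 1 := ⟨by positivity, hzt⟩
  rw [integral_norm_sq_tsum_mul_circleMap ht (hμ.summable_norm_derivDiffCoeff hρ)]
  obtain ⟨hsum, hle⟩ := hmoment _ hρ
  have hterm (n : ℕ) : ‖derivDiffCoeff μ n‖ ^ 2 * (‖z‖ * t) ^ (2 * n) ≤
      C₁ ^ 2 * ((‖z‖ * t) ^ (2 * n) / evenMoment μ n ^ 2) :=
    calc _ ≤ (C₁ / evenMoment μ n) ^ 2 * (‖z‖ * t) ^ (2 * n) := by gcongr; exact hcoeff n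
      _ = _ := by ring
  have hsum' := (hsum.mul_left (C₁ ^ 2)).of_nonneg_of_le (fun n => by positivity) hterm
  calc _ ≤ C₁ ^ 2 * ∑' n, (‖z‖ * t) ^ (2 * n) / evenMoment μ n ^ 2 := by
        rw [← tsum_mul_left]; exact hsum'.tsum_le_tsum hterm (hsum.mul_left _)
    _ ≤ _ := by rw [mul_div_assoc]; gcongr

lemma exists_integral_norm_derivCoeff_le (hμ : IsUpperDoublingMeasure μ) :
    ∃ C > 0, ∀ z : ℂ, ∀ t : ℝ, 0 ≤ t → ‖z‖ * t < 1 →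
      ∫ θ, ‖∑' n, derivCoeff μ n * (z * circleMap 0 t θ) ^ n‖ ∂angleMeasure ≤
        C / ((1 - ‖z‖ * t) * tailMass μ (‖z‖ * t)) := by
  obtain ⟨C, hC, hdiff⟩ := hμ.exists_integral_norm_sq_derivDiffCoeff_le
  refine ⟨C + 1, by positivity, fun z t ht hzt => ?_⟩
  have hρ : ‖z‖ * t ∈ Ico (0 : ℝ) 1 := ⟨by positivity, hzt⟩
  have h1ρ : 0 < 1 - ‖z‖ * t := sub_pos.2 hzt
  have hT := hμ.tailMass_pos _ hzt
  set T := tailMass μ (‖z‖ * t)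
  have hnorm (θ : ℝ) : ‖z * circleMap 0 t θ‖ < 1 := by
    rwa [norm_mul, norm_circleMap_zero, abs_of_nonneg ht]
  have hdiffInt : Integrable
      (fun θ => ‖∑' n, derivDiffCoeff μ n * (z * circleMap 0 t θ) ^ n‖ ^ 2) angleMeasure :=
    integrable_angleMeasure_of_continuous
      ((continuous_tsum_mul_circleMap ht (hμ.summable_norm_derivDiffCoeff hρ)).norm.pow 2)
  have hgeomCont := continuous_tsum_mul_circleMap (a := 1) (z := z) ht
    (by simpa using summable_geometric_of_lt_one hρ.1 hρ.2)
  simp only [Pi.one_apply, one_mul] at hgeomCont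
  have hgeomInt : Integrable (fun θ => ‖∑' n, (z * circleMap 0 t θ) ^ n‖ ^ 2) angleMeasure :=
    integrable_angleMeasure_of_continuous (hgeomCont.norm.pow 2)
  calc _ ≤ ∫ θ, (T * ‖∑' n, derivDiffCoeff μ n * (z * circleMap 0 t θ) ^ n‖ ^ 2 +
        T⁻¹ * ‖∑' n, (z * circleMap 0 t θ) ^ n‖ ^ 2) ∂angleMeasure :=
        integral_mono (integrable_angleMeasure_of_continuous
          (continuous_tsum_mul_circleMap ht (hμ.summable_norm_derivCoeff hρ)).norm)
          ((hdiffInt.const_mul _).add (hgeomInt.const_mul _))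
          fun θ => hμ.norm_tsum_derivCoeff_le (hnorm θ) hT
    _ ≤ T * (C / ((1 - ‖z‖ * t) * T ^ 2)) + T⁻¹ * (1 / (1 - ‖z‖ * t)) := by
        rw [integral_add (hdiffInt.const_mul _) (hgeomInt.const_mul _), integral_const_mul,
          integral_const_mul]
        gcongr
        exacts [hdiff z t ht hzt, integral_norm_sq_geometric_circleMap_le ht hzt]
    _ = _ := by field_simp

end IsUpperDoublingMeasure

lemma norm_tsum_derivCoeff_mul_conj (μ : Measure ℝ) (z ξ : ℂ) :
    ‖∑' n, derivCoeff μ n * (z * conj ξ) ^ n‖ = ‖∑' n, derivCoeff μ n * (conj z * ξ) ^ n‖ := by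
  rw [← RCLike.norm_conj (∑' n, derivCoeff μ n * (conj z * ξ) ^ n), Complex.conj_tsum]
  simp [derivCoeff]

namespace IsRadialWeight

variable {ω : ℂ → ℝ} {Φ : ℂ → ℂ} {z : ℂ}

lemma exists_lintegral_derivCoeff_le (hω : IsRadialWeight ω)
    (hμ : IsUpperDoublingMeasure (radialMeasure ω)) :
    ∃ M > 0, ∀ z ∈ ball (0 : ℂ) 1,
      ∫⁻ ξ, ‖∑' n, derivCoeff (radialMeasure ω) n * (z * conj ξ) ^ n‖ₑ ∂weightMeasure ω ≤
        ENNReal.ofReal (M / (1 - ‖z‖)) := by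
  obtain ⟨C, hC, hcircle⟩ := hμ.exists_integral_norm_derivCoeff_le
  obtain ⟨A, hA, htail⟩ := hμ.exists_lintegral_one_div_tailMass_le
  refine ⟨C * A, by positivity, fun z hz => ?_⟩
  have hz1 : ‖z‖ < 1 := mem_ball_zero_iff.1 hz
  have hd : DifferentiableOn ℂ
      (fun ξ => ∑' n, derivCoeff (radialMeasure ω) n * (conj z * ξ) ^ n) (ball 0 1) :=
    (differentiableOn_powerSeries fun _ hr => hμ.summable_norm_derivCoeff hr).comp
      (by fun_prop) (mapsTo_conj_mul_ball hz)
  simp_rw [← ofReal_norm, norm_tsum_derivCoeff_mul_conj, ofReal_norm]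
  rw [hω.lintegral_weightMeasure_circleMap
    (aestronglyMeasurable_weightMeasure hd.continuousOn).enorm]
  calc _ ≤ ∫⁻ t, ENNReal.ofReal C * ENNReal.ofReal
          (1 / ((1 - ‖z‖ * t) * tailMass (radialMeasure ω) (‖z‖ * t))) ∂radialMeasure ω := by
        refine lintegral_mono_ae ?_
        filter_upwards [ae_radialMeasure_mem_Ioo ω] with t ht
        have hzt : ‖z‖ * t < 1 := mul_lt_one_of_nonneg_of_lt_one_left (norm_nonneg z) hz1 ht.2.le
        have hle := hcircle (conj z) t ht.1.le (by rwa [RCLike.norm_conj])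
        have hcont := continuous_tsum_mul_circleMap (z := conj z) ht.1.le
          (hμ.summable_norm_derivCoeff ⟨by have := ht.1; positivity, by rwa [RCLike.norm_conj]⟩)
        rw [RCLike.norm_conj] at hle
        rw [← ofReal_integral_norm_eq_lintegral_enorm (integrable_angleMeasure_of_continuous hcont),
          ← ENNReal.ofReal_mul hC.le, mul_one_div]
        exact ENNReal.ofReal_le_ofReal hle
    _ = ENNReal.ofReal C * ∫⁻ t, ENNReal.ofReal
          (1 / ((1 - ‖z‖ * t) * tailMass (radialMeasure ω) (‖z‖ * t))) ∂radialMeasure ω :=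
        lintegral_const_mul' _ _ ENNReal.ofReal_ne_top
    _ ≤ ENNReal.ofReal C * ENNReal.ofReal (A / (1 - ‖z‖)) := by
        gcongr
        exact htail _ ⟨norm_nonneg _, hz1⟩
    _ = _ := by rw [← ENNReal.ofReal_mul hC.le, mul_div_assoc]

lemma summable_norm_projCoeff (hω : IsRadialWeight ω) (hΦ : Integrable Φ (weightMeasure ω))
    {r : ℝ} (hr : r ∈ Ico (0 : ℝ) 1) : Summable fun n => ‖projCoeff ω Φ n‖ * r ^ n := by
  refine ((hω.isRadialMeasure.summable_norm_inv_evenMoment hr).mul_left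
    (∫ ξ, ‖Φ ξ‖ ∂weightMeasure ω)).of_nonneg_of_le
    (fun n => mul_nonneg (norm_nonneg _) (pow_nonneg hr.1 n)) fun n => ?_
  have hle : ‖∫ ξ, Φ ξ * conj ξ ^ n ∂weightMeasure ω‖ ≤ ∫ ξ, ‖Φ ξ‖ ∂weightMeasure ω := by
    refine norm_integral_le_of_norm_le hΦ.norm ?_
    filter_upwards [ae_weightMeasure_mem_ball ω] with ξ hξ
    rw [norm_mul, norm_pow, RCLike.norm_conj]
    exact mul_le_of_le_one_right (norm_nonneg _)
      (pow_le_one₀ (norm_nonneg _) (mem_ball_zero_iff.1 hξ).le)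
  rw [projCoeff, norm_mul, mul_comm ‖_‖, mul_assoc]
  exact mul_le_mul_of_nonneg_right hle (mul_nonneg (norm_nonneg _) (pow_nonneg hr.1 n))

lemma eqOn_bergmanProjection (hω : IsRadialWeight ω) (hΦ : Integrable Φ (weightMeasure ω)) :
    EqOn (bergmanProjection ω Φ) (fun z => ∑' n, projCoeff ω Φ n * z ^ n) (ball 0 1) :=
  fun _ hz => (hω.hasSum_bergmanProjection hΦ hz).tsum_eq.symm

lemma differentiableOn_bergmanProjection (hω : IsRadialWeight ω)
    (hΦ : Integrable Φ (weightMeasure ω)) :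
    DifferentiableOn ℂ (bergmanProjection ω Φ) (ball 0 1) :=
  (differentiableOn_powerSeries fun _ hr => hω.summable_norm_projCoeff hΦ hr).congr
    (hω.eqOn_bergmanProjection hΦ)

lemma hasSum_deriv_bergmanProjection (hω : IsRadialWeight ω)
    (hΦ : Integrable Φ (weightMeasure ω)) (hz : z ∈ ball (0 : ℂ) 1) :
    HasSum (fun n : ℕ => (n + 1) * projCoeff ω Φ (n + 1) * z ^ n)
      (deriv (bergmanProjection ω Φ) z) := by
  rw [((hω.eqOn_bergmanProjection hΦ).eventuallyEq_of_mem (isOpen_ball.mem_nhds hz)).deriv_eq]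
  exact hasSum_deriv_powerSeries (fun _ hr => hω.summable_norm_projCoeff hΦ hr) hz

lemma deriv_bergmanProjection (hω : IsRadialWeight ω) (hΦ : Integrable Φ (weightMeasure ω))
    (hz : z ∈ ball (0 : ℂ) 1) :
    deriv (bergmanProjection ω Φ) z = ∫ ξ, Φ ξ * conj ξ *
      ∑' n, derivCoeff (radialMeasure ω) n * (z * conj ξ) ^ n ∂weightMeasure ω := by
  have hΦ' : Integrable (fun ξ => Φ ξ * conj ξ) (weightMeasure ω) := by
    simpa only [pow_one] using integrable_mul_conj_pow hΦ 1
  refine (hω.hasSum_deriv_bergmanProjection hΦ hz).unique ?_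
  convert! hasSum_integral_mul_tsum_mul_conj_pow hΦ'
    (hω.isRadialMeasure.summable_norm_derivCoeff ⟨norm_nonneg z, mem_ball_zero_iff.1 hz⟩) using 1
  ext n
  rw [projCoeff, derivCoeff]
  simp_rw [pow_succ', mul_assoc]
  push_cast
  ring

lemma enorm_deriv_bergmanProjection_le (hω : IsRadialWeight ω)
    (hΦ : Integrable Φ (weightMeasure ω)) {S : ℝ≥0} (hΦS : ∀ z ∈ ball (0 : ℂ) 1, ‖Φ z‖ ≤ S)
    (hz : z ∈ ball (0 : ℂ) 1) :
    ‖deriv (bergmanProjection ω Φ) z‖ₑ ≤ S *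
      ∫⁻ ξ, ‖∑' n, derivCoeff (radialMeasure ω) n * (z * conj ξ) ^ n‖ₑ ∂weightMeasure ω := by
  rw [hω.deriv_bergmanProjection hΦ hz, ← lintegral_const_mul' _ _ ENNReal.coe_ne_top]
  refine (enorm_integral_le_lintegral_enorm _).trans (lintegral_mono_ae ?_)
  filter_upwards [ae_weightMeasure_mem_ball ω] with ξ hξ
  rw [enorm_mul]
  gcongr
  rw [enorm_le_coe, ← NNReal.coe_le_coe, coe_nnnorm, norm_mul, RCLike.norm_conj]
  exact (mul_le_of_le_one_right (norm_nonneg _) (mem_ball_zero_iff.1 hξ).le).trans (hΦS ξ hξ)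

lemma norm_bergmanProjection_zero_le (hω : IsRadialWeight ω)
    (hΦ : Integrable Φ (weightMeasure ω)) {S : ℝ} (hΦS : ∀ z ∈ ball (0 : ℂ) 1, ‖Φ z‖ ≤ S) :
    ‖bergmanProjection ω Φ 0‖ ≤
      (evenMoment (radialMeasure ω) 0)⁻¹ * (weightMeasure ω).real univ * S := by
  have h0 : bergmanProjection ω Φ 0 = projCoeff ω Φ 0 := by
    refine (hω.hasSum_bergmanProjection hΦ (mem_ball_self one_pos)).unique ?_
    simpa using hasSum_single (f := fun n => projCoeff ω Φ n * 0 ^ n) 0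
      fun n hn => by simp [hn]
  have := hω.isFiniteMeasure_weightMeasure
  rw [h0, projCoeff, norm_mul, hω.isRadialMeasure.norm_inv_evenMoment, mul_assoc,
    mul_comm (Measure.real _ _)]
  simp only [pow_zero, mul_one]
  exact mul_le_mul_of_nonneg_left
    (norm_integral_le_of_norm_le_const ((ae_weightMeasure_mem_ball ω).mono hΦS))
    (inv_nonneg.2 (hω.isRadialMeasure.evenMoment_pos 0).le)

theorem exists_blochNorm_bergmanProjection_le (hω : IsRadialWeight ω)
    (hμ : IsUpperDoublingMeasure (radialMeasure ω)) :
    ∃ M : ℝ≥0, ∀ (Φ : ℂ → ℂ) (S : ℝ≥0), ContinuousOn Φ (ball 0 1) →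
      (∀ z ∈ ball (0 : ℂ) 1, ‖Φ z‖ ≤ S) → blochNorm (bergmanProjection ω Φ) ≤ M * S := by
  obtain ⟨M, hM, hkernel⟩ := hω.exists_lintegral_derivCoeff_le hμ
  have hm₀ := hμ.evenMoment_pos 0
  set c₀ := (evenMoment (radialMeasure ω) 0)⁻¹ * (weightMeasure ω).real univ
  have hc₀ : 0 ≤ c₀ := by positivity
  refine ⟨(2 * M).toNNReal + c₀.toNNReal, fun Φ S hΦc hΦS => ?_⟩
  have hΦ := hω.integrable_of_continuousOn_of_bound hΦc S hΦS
  rw [blochNorm, ENNReal.coe_add, add_mul]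
  refine add_le_add (iSup₂_le fun z hz => ?_) ?_
  · have h1z : 0 < 1 - ‖z‖ := sub_pos.2 (mem_ball_zero_iff.1 hz)
    have hnonneg : 0 ≤ 1 - ‖z‖ ^ 2 := by nlinarith [norm_nonneg z]
    rw [ENNReal.ofReal_mul hnonneg, ofReal_norm]
    calc ENNReal.ofReal (1 - ‖z‖ ^ 2) * ‖deriv (bergmanProjection ω Φ) z‖ₑ
        ≤ ENNReal.ofReal (1 - ‖z‖ ^ 2) * (S * ENNReal.ofReal (M / (1 - ‖z‖))) := by
          gcongr
          exact (hω.enorm_deriv_bergmanProjection_le hΦ hΦS hz).trans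
            (mul_le_mul_right (hkernel z hz) _)
      _ = ENNReal.ofReal ((1 - ‖z‖ ^ 2) * (M / (1 - ‖z‖))) * S := by
          rw [ENNReal.ofReal_mul hnonneg]; ring
      _ ≤ ENNReal.ofReal (2 * M) * S := by
          refine mul_le_mul_left (ENNReal.ofReal_le_ofReal ?_) _
          rw [mul_div_assoc', div_le_iff₀ h1z]
          nlinarith [mul_nonneg hM.le (mul_nonneg h1z.le h1z.le)]
  · rw [← ofReal_norm]
    refine (ENNReal.ofReal_le_ofReal (hω.norm_bergmanProjection_zero_le hΦ hΦS)).trans_eq ?_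
    rw [ENNReal.ofReal_mul hc₀, ENNReal.ofReal_coe_nnreal]
    rfl

end IsRadialWeight

/-! ### The range lies in the little Bloch space -/

section DiskExtend

variable (Φ : C(closedBall (0 : ℂ) 1, ℂ))

lemma diskExtend_apply {z : ℂ} (hz : z ∈ closedBall (0 : ℂ) 1) : diskExtend Φ z = Φ ⟨z, hz⟩ :=
  Subtype.val_injective.extend_apply Φ 0 ⟨z, hz⟩

lemma continuousOn_diskExtend : ContinuousOn (diskExtend Φ) (ball 0 1) := by
  refine ContinuousOn.mono ?_ ball_subset_closedBall
  rw [continuousOn_iff_continuous_domRestrict]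
  convert Φ.continuous using 1
  ext z
  exact diskExtend_apply Φ z.2

lemma norm_diskExtend_le {z : ℂ} (hz : z ∈ ball (0 : ℂ) 1) : ‖diskExtend Φ z‖ ≤ ‖Φ‖₊ := by
  rw [diskExtend_apply Φ (ball_subset_closedBall hz)]
  exact Φ.norm_coe_le_norm _

end DiskExtend

namespace IsRadialWeight

variable {ω : ℂ → ℝ} {z : ℂ}

lemma integrable_diskExtend (hω : IsRadialWeight ω) (Φ : C(closedBall (0 : ℂ) 1, ℂ)) :
    Integrable (diskExtend Φ) (weightMeasure ω) :=
  hω.integrable_of_continuousOn_of_bound (continuousOn_diskExtend Φ) ‖Φ‖₊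
    fun _ hz => norm_diskExtend_le Φ hz

lemma projCoeff_diskExtend_add (hω : IsRadialWeight ω) (Φ Ψ : C(closedBall (0 : ℂ) 1, ℂ)) (n : ℕ) :
    projCoeff ω (diskExtend (Φ + Ψ)) n =
      projCoeff ω (diskExtend Φ) n + projCoeff ω (diskExtend Ψ) n := by
  rw [projCoeff, projCoeff, projCoeff, ← mul_add,
    ← integral_add (integrable_mul_conj_pow (hω.integrable_diskExtend Φ) n)
      (integrable_mul_conj_pow (hω.integrable_diskExtend Ψ) n)]
  congr 1
  refine integral_congr_ae ?_
  filter_upwards [ae_weightMeasure_mem_ball ω] with ξ hξ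
  have hξ' := ball_subset_closedBall hξ
  rw [diskExtend_apply _ hξ', diskExtend_apply _ hξ', diskExtend_apply _ hξ',
    ContinuousMap.add_apply, add_mul]

lemma deriv_bergmanProjection_add (hω : IsRadialWeight ω) (Φ Ψ : C(closedBall (0 : ℂ) 1, ℂ))
    (hz : z ∈ ball (0 : ℂ) 1) :
    deriv (bergmanProjection ω (diskExtend (Φ + Ψ))) z =
      deriv (bergmanProjection ω (diskExtend Φ)) z +
        deriv (bergmanProjection ω (diskExtend Ψ)) z := by
  refine (hω.hasSum_deriv_bergmanProjection (hω.integrable_diskExtend _) hz).unique ?_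
  convert! (hω.hasSum_deriv_bergmanProjection (hω.integrable_diskExtend Φ) hz).add
    (hω.hasSum_deriv_bergmanProjection (hω.integrable_diskExtend Ψ) hz) using 1
  ext n
  rw [hω.projCoeff_diskExtend_add]
  ring

end IsRadialWeight

lemma projCoeff_diskExtend_smul (ω : ℂ → ℝ) (c : ℂ) (Φ : C(closedBall (0 : ℂ) 1, ℂ)) (n : ℕ) :
    projCoeff ω (diskExtend (c • Φ)) n = c * projCoeff ω (diskExtend Φ) n := by
  rw [projCoeff, projCoeff, mul_left_comm, ← integral_const_mul c]
  congr 1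
  refine integral_congr_ae ?_
  filter_upwards [ae_weightMeasure_mem_ball ω] with ξ hξ
  have hξ' := ball_subset_closedBall hξ
  rw [diskExtend_apply _ hξ', diskExtend_apply _ hξ', ContinuousMap.smul_apply, smul_eq_mul,
    mul_assoc]

lemma IsRadialWeight.deriv_bergmanProjection_smul {ω : ℂ → ℝ} (hω : IsRadialWeight ω) (c : ℂ)
    (Φ : C(closedBall (0 : ℂ) 1, ℂ)) {z : ℂ} (hz : z ∈ ball (0 : ℂ) 1) :
    deriv (bergmanProjection ω (diskExtend (c • Φ))) z =
      c * deriv (bergmanProjection ω (diskExtend Φ)) z := by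
  refine (hω.hasSum_deriv_bergmanProjection (hω.integrable_diskExtend _) hz).unique ?_
  convert! (hω.hasSum_deriv_bergmanProjection (hω.integrable_diskExtend Φ) hz).mul_left c using 1
  ext n
  rw [projCoeff_diskExtend_smul]
  ring

lemma tendsto_zero_of_dense_span {ι 𝕜 E F : Type*} [NormedField 𝕜] [SeminormedAddCommGroup E]
    [NormedSpace 𝕜 E] [SeminormedAddCommGroup F] [NormedSpace 𝕜 F] {l : Filter ι}
    {T : ι → E →ₗ[𝕜] F} {M : ℝ} (hT : ∀ i x, ‖T i x‖ ≤ M * ‖x‖) {s : Set E}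
    (hs : (Submodule.span 𝕜 s).topologicalClosure = ⊤)
    (hlim : ∀ x ∈ s, Tendsto (fun i => T i x) l (𝓝 0)) (x : E) :
    Tendsto (fun i => T i x) l (𝓝 0) := by
  let V : Submodule 𝕜 E :=
    { carrier := {x | Tendsto (fun i => T i x) l (𝓝 0)}
      zero_mem' := by simp [tendsto_const_nhds]
      add_mem' := fun hx hy => by simpa using Tendsto.add hx hy
      smul_mem' := fun c _ hx => by simpa using Tendsto.const_smul hx c }
  have hequi : Equicontinuous fun i => (T i : E → F) :=
    (LipschitzWith.uniformEquicontinuous _ M.toNNReal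
      fun i => AddMonoidHomClass.lipschitz_of_bound (T i) M (hT i)).equicontinuous
  have hclosed : IsClosed (V : Set E) := hequi.isClosed_setOfPred_tendsto continuous_const
  have hspan : (Submodule.span 𝕜 s).topologicalClosure ≤ V :=
    Submodule.topologicalClosure_minimal _ (Submodule.span_le.2 hlim) hclosed
  exact hspan (hs ▸ Submodule.mem_top)

lemma one_sub_norm_sq_nonneg {z : ℂ} (hz : z ∈ ball (0 : ℂ) 1) : 0 ≤ 1 - ‖z‖ ^ 2 :=
  sub_nonneg.2 (pow_le_one₀ (norm_nonneg z) (mem_ball_zero_iff.1 hz).le)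

lemma eventually_mem_ball_comap_norm :
    ∀ᶠ z : ℂ in comap norm (𝓝[<] (1 : ℝ)), z ∈ ball (0 : ℂ) 1 := by
  have h : ∀ᶠ x in 𝓝[<] (1 : ℝ), x < 1 := self_mem_nhdsWithin
  simpa only [mem_ball_zero_iff] using h.comap (norm : ℂ → ℝ)

lemma tendsto_one_sub_norm_sq_mul_of_bound {g : ℂ → ℂ} (B : ℝ)
    (hB : ∀ z ∈ ball (0 : ℂ) 1, ‖g z‖ ≤ B) :
    Tendsto (fun z : ℂ => (1 - ‖z‖ ^ 2) * ‖g z‖) (comap norm (𝓝[<] (1 : ℝ))) (𝓝 0) := by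
  have hnorm : Tendsto (norm : ℂ → ℝ) (comap norm (𝓝[<] (1 : ℝ))) (𝓝 1) :=
    tendsto_comap.mono_right nhdsWithin_le_nhds
  have hbound : Tendsto (fun z : ℂ => (1 - ‖z‖ ^ 2) * B) (comap norm (𝓝[<] (1 : ℝ))) (𝓝 0) := by
    simpa using ((hnorm.pow 2).const_sub 1).mul_const B
  refine squeeze_zero' ?_ ?_ hbound <;>
    filter_upwards [eventually_mem_ball_comap_norm] with z hz
  · exact mul_nonneg (one_sub_norm_sq_nonneg hz) (norm_nonneg _)
  · exact mul_le_mul_of_nonneg_left (hB z hz) (one_sub_norm_sq_nonneg hz)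

/-- The coordinate function on the closed disk. -/
def diskCoord : C(closedBall (0 : ℂ) 1, ℂ) := ContinuousMap.restrict _ (.id ℂ)

/-- The monomials `z ^ a * conj z ^ b` on the closed disk. -/
def diskMonomials : Set C(closedBall (0 : ℂ) 1, ℂ) :=
  range fun p : ℕ × ℕ => diskCoord ^ p.1 * star diskCoord ^ p.2

lemma topologicalClosure_span_diskMonomials :
    (Submodule.span ℂ diskMonomials).topologicalClosure = ⊤ := by
  have hspan : Submodule.span ℂ diskMonomials =
      Subalgebra.toSubmodule (StarAlgebra.adjoin ℂ {diskCoord}).toSubalgebra := by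
    rw [StarAlgebra.adjoin_toSubalgebra, Algebra.adjoin_eq_span]
    congr 1
    ext Φ
    rw [star_singleton, singleton_union, SetLike.mem_coe, Submonoid.mem_closure_pair]
    simp [diskMonomials]
  have hdense (Φ : C(closedBall (0 : ℂ) 1, ℂ)) :
      Φ ∈ StarAlgebra.elemental ℂ (ContinuousMap.restrict (closedBall (0 : ℂ) 1) (.id ℂ)) := by
    rw [ContinuousMap.elemental_id_eq_top (closedBall (0 : ℂ) 1)]
    trivial
  rw [hspan]
  exact SetLike.ext fun Φ => iff_of_true (hdense Φ) trivial

namespace IsRadialWeight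

variable {ω : ℂ → ℝ}

lemma projCoeff_diskMonomial_eq_zero (hω : IsRadialWeight ω) (b : ℕ) {a n : ℕ} (hn : a < n) :
    projCoeff ω (diskExtend (diskCoord ^ a * star diskCoord ^ b)) n = 0 := by
  rw [projCoeff, hω.integral_weightMeasure_circleMap
    (integrable_mul_conj_pow (hω.integrable_diskExtend _) n)]
  refine mul_eq_zero_of_right _ (integral_eq_zero_of_ae ?_)
  filter_upwards [ae_radialMeasure_mem_Ioo ω] with t ht
  have hmonomial (θ : ℝ) : diskExtend (diskCoord ^ a * star diskCoord ^ b) (circleMap 0 t θ) *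
      conj (circleMap 0 t θ) ^ n = circleMap 0 t θ ^ a * conj (circleMap 0 t θ) ^ (b + n) := by
    rw [diskExtend_apply _ (by simpa [abs_of_pos ht.1] using ht.2.le), pow_add, ← mul_assoc]
    rfl
  simp_rw [hmonomial]
  rw [integral_circleMap_pow_mul_conj_pow, if_neg (by omega)]
  rfl

lemma tendsto_deriv_bergmanProjection_diskMonomial (hω : IsRadialWeight ω) (a b : ℕ) :
    Tendsto (fun z : ℂ => (1 - ‖z‖ ^ 2) * ‖deriv (bergmanProjection ω
      (diskExtend (diskCoord ^ a * star diskCoord ^ b))) z‖) (comap norm (𝓝[<] (1 : ℝ))) (𝓝 0) := by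
  refine tendsto_one_sub_norm_sq_mul_of_bound (∑ n ∈ Finset.range a, ‖(n + 1) *
    projCoeff ω (diskExtend (diskCoord ^ a * star diskCoord ^ b)) (n + 1)‖) fun z hz => ?_
  rw [(hω.hasSum_deriv_bergmanProjection (hω.integrable_diskExtend _) hz).unique
    (hasSum_sum_of_ne_finset_zero (s := Finset.range a) fun n hn => by
      rw [hω.projCoeff_diskMonomial_eq_zero b (by simpa [Nat.lt_succ_iff] using hn), mul_zero,
        zero_mul])]
  refine norm_sum_le_of_le _ fun n _ => ?_
  rw [norm_mul _ (z ^ n), norm_pow]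
  exact mul_le_of_le_one_right (norm_nonneg _)
    (pow_le_one₀ (norm_nonneg _) (mem_ball_zero_iff.1 hz).le)

/-- The functional `Φ ↦ (1 - ‖z‖²) (P_ω Φ)'(z)` whose size enters the Bloch norm. -/
def blochFunctional (hω : IsRadialWeight ω) (z : ball (0 : ℂ) 1) :
    C(closedBall (0 : ℂ) 1, ℂ) →ₗ[ℂ] ℂ where
  toFun Φ := ((1 - ‖(z : ℂ)‖ ^ 2 : ℝ) : ℂ) * deriv (bergmanProjection ω (diskExtend Φ)) z
  map_add' Φ Ψ := by rw [hω.deriv_bergmanProjection_add Φ Ψ z.2, mul_add]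
  map_smul' c Φ := by
    rw [hω.deriv_bergmanProjection_smul c Φ z.2, mul_left_comm, RingHom.id_apply, smul_eq_mul]

lemma norm_blochFunctional (hω : IsRadialWeight ω) (z : ball (0 : ℂ) 1)
    (Φ : C(closedBall (0 : ℂ) 1, ℂ)) :
    ‖hω.blochFunctional z Φ‖ =
      (1 - ‖(z : ℂ)‖ ^ 2) * ‖deriv (bergmanProjection ω (diskExtend Φ)) z‖ := by
  rw [blochFunctional, LinearMap.coe_mk, AddHom.coe_mk, norm_mul,
    Complex.norm_of_nonneg (one_sub_norm_sq_nonneg z.2)]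

lemma tendsto_blochFunctional_iff (hω : IsRadialWeight ω) (Φ : C(closedBall (0 : ℂ) 1, ℂ)) :
    Tendsto (fun z => hω.blochFunctional z Φ)
        (comap Subtype.val (comap norm (𝓝[<] (1 : ℝ)))) (𝓝 0) ↔
      Tendsto (fun z : ℂ => (1 - ‖z‖ ^ 2) * ‖deriv (bergmanProjection ω (diskExtend Φ)) z‖)
        (comap norm (𝓝[<] (1 : ℝ))) (𝓝 0) := by
  rw [tendsto_zero_iff_norm_tendsto_zero]
  simp_rw [norm_blochFunctional]
  refine tendsto_comap'_iff (i := Subtype.val)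
    (m := fun z => (1 - ‖z‖ ^ 2) * ‖deriv (bergmanProjection ω (diskExtend Φ)) z‖) ?_
  rw [Subtype.range_coe]; exact eventually_mem_ball_comap_norm

lemma exists_norm_blochFunctional_le (hω : IsRadialWeight ω)
    (hμ : IsUpperDoublingMeasure (radialMeasure ω)) :
    ∃ M : ℝ, ∀ z Φ, ‖hω.blochFunctional z Φ‖ ≤ M * ‖Φ‖ := by
  obtain ⟨M, hM⟩ := hω.exists_blochNorm_bergmanProjection_le hμ
  refine ⟨M, fun z Φ => ?_⟩
  have hle : ENNReal.ofReal ‖hω.blochFunctional z Φ‖ ≤ (M * ‖Φ‖₊ : ℝ≥0) := by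
    rw [norm_blochFunctional, ENNReal.coe_mul]
    refine le_trans ?_ (hM (diskExtend Φ) ‖Φ‖₊ (continuousOn_diskExtend Φ)
      fun w hw => norm_diskExtend_le Φ hw)
    exact (le_iSup₂ (f := fun z (_ : z ∈ ball (0 : ℂ) 1) => ENNReal.ofReal
      ((1 - ‖z‖ ^ 2) * ‖deriv (bergmanProjection ω (diskExtend Φ)) z‖)) z.1 z.2).trans le_self_add
  exact ENNReal.ofReal_le_coe.1 hle

theorem memLittleBloch_bergmanProjection (hω : IsRadialWeight ω)
    (hμ : IsUpperDoublingMeasure (radialMeasure ω)) (Φ : C(closedBall (0 : ℂ) 1, ℂ)) :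
    MemLittleBloch (bergmanProjection ω (diskExtend Φ)) := by
  obtain ⟨M, hM⟩ := hω.exists_blochNorm_bergmanProjection_le hμ
  obtain ⟨N, hN⟩ := hω.exists_norm_blochFunctional_le hμ
  refine ⟨⟨hω.differentiableOn_bergmanProjection (hω.integrable_diskExtend Φ), ?_⟩, ?_⟩
  · exact (hM _ ‖Φ‖₊ (continuousOn_diskExtend Φ) fun w hw => norm_diskExtend_le Φ hw).trans_lt
      (ENNReal.mul_lt_top ENNReal.coe_lt_top ENNReal.coe_lt_top)
  · rw [← hω.tendsto_blochFunctional_iff]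
    refine tendsto_zero_of_dense_span hN topologicalClosure_span_diskMonomials ?_ Φ
    rintro _ ⟨⟨a, b⟩, rfl⟩
    exact (hω.tendsto_blochFunctional_iff _).2
      (hω.tendsto_deriv_bergmanProjection_diskMonomial a b)

end IsRadialWeight

/-! ### Surjectivity onto the little Bloch space -/

lemma continuous_tailMass (μ : Measure ℝ) [IsFiniteMeasure μ] [NullSingletonClass μ] :
    Continuous (tailMass μ) := by
  have htail (r : ℝ) : tailMass μ r = tailMass μ 0 - ∫ _ in (0 : ℝ)..r, (1 : ℝ) ∂μ := by
    rw [← intervalIntegral.integral_Ioi_sub_Ioi' (integrable_const _) (integrable_const _)]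
    simp [tailMass]
  rw [funext htail]
  exact continuous_const.sub
    (intervalIntegral.continuous_primitive (fun _ _ => intervalIntegrable_const) 0)

/-- The ratio of the tail mass at `s` to the mass of `(s, 1 - (1 - s) / K]`. -/
def sweepRatio (μ : Measure ℝ) (K s : ℝ) : ℝ :=
  tailMass μ s / (tailMass μ s - tailMass μ (1 - (1 - s) / K))

/-- The density with respect to `μ`, on `(s, 1 - (1 - s) / K]`, of a measure whose total mass is
the tail mass at `s`. The condition `s < t` is left to the users of the kernel, which integrate
over `s = x * t` with `x < 1`. -/
def sweepKernel (μ : Measure ℝ) (K t s : ℝ) : ℝ :=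
  if 1 - s ≤ K * (1 - t) then sweepRatio μ K s else 0

/-- The factor by which `sweep`, applied to the derivative of `z ^ (k + 1)`, changes the values of
`z ^ (k + 1)` on the circle of radius `t`. -/
def sweepMultiplier (μ : Measure ℝ) (K : ℝ) (k : ℕ) (t : ℝ) : ℝ :=
  ∫ x in Ioo (0 : ℝ) 1, (2 * k + 2) * (sweepKernel μ K t (x * t) * x ^ (2 * k + 1))

/-- Sweeping of `g` along the radii; applied to the derivative of a function, it is a right inverse
of the Bergman projection up to constants. -/
def sweep (μ : Measure ℝ) (K : ℝ) (g : ℂ → ℂ) (ξ : ℂ) : ℂ :=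
  2 * ξ * ∫ x in Ioo (0 : ℝ) 1, ((sweepKernel μ K ‖ξ‖ (x * ‖ξ‖) * x : ℝ) : ℂ) * g ((x : ℂ) ^ 2 * ξ)

lemma mul_mem_Ico {x t : ℝ} (hx : x ∈ Ioo (0 : ℝ) 1) (ht : t ∈ Ico (0 : ℝ) 1) :
    x * t ∈ Ico (0 : ℝ) 1 :=
  ⟨mul_nonneg hx.1.le ht.1, mul_lt_one_of_nonneg_of_lt_one_left hx.1.le hx.2 ht.2.le⟩

lemma norm_ofReal_sq_mul_le {x : ℝ} (hx : x ∈ Ioo (0 : ℝ) 1) (ξ : ℂ) :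
    ‖(x : ℂ) ^ 2 * ξ‖ ≤ ‖ξ‖ := by
  rw [norm_mul, norm_pow, Complex.norm_real, Real.norm_of_nonneg hx.1.le]
  exact mul_le_of_le_one_left (norm_nonneg _) (pow_le_one₀ hx.1.le hx.2.le)

lemma ae_one_sub_mul_ne {K t : ℝ} (hK : 1 < K) (ht : t < 1) :
    ∀ᵐ x : ℝ, 1 - x * t ≠ K * (1 - t) := by
  rcases eq_or_ne t 0 with rfl | ht0
  · exact .of_forall fun x hx => hK.ne (by linarith)
  · filter_upwards [Measure.ae_ne volume ((1 - K * (1 - t)) / t)] with x hx heq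
    exact hx ((eq_div_iff ht0).2 (by linarith))

lemma sweepMultiplier_mul_pow (μ : Measure ℝ) (K : ℝ) (k : ℕ) {t : ℝ} (ht : t ∈ Ioo (0 : ℝ) 1) :
    sweepMultiplier μ K k t * t ^ (2 * (k + 1)) =
      ∫ s in Ioo (0 : ℝ) 1,
        (Ioi s).indicator (sweepKernel μ K · s) t * ((2 * k + 2) * s ^ (2 * k + 1)) := by
  set f : ℝ → ℝ := fun s => sweepKernel μ K t s * ((2 * k + 2) * s ^ (2 * k + 1)) with hf
  have hscale : sweepMultiplier μ K k t * t ^ (2 * (k + 1)) = t * ∫ x in 0..1, f (x * t) := by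
    rw [sweepMultiplier, ← integral_Ioc_eq_integral_Ioo,
      ← intervalIntegral.integral_of_le zero_le_one, ← intervalIntegral.integral_mul_const,
      ← intervalIntegral.integral_const_mul]
    refine intervalIntegral.integral_congr fun x _ => ?_
    simp only [hf]
    ring
  have hindicator (s : ℝ) : (Ioi s).indicator (sweepKernel μ K · s) t *
      ((2 * k + 2) * s ^ (2 * k + 1)) = (Iio t).indicator f s := by
    by_cases h : s < t <;> simp [h, hf, indicator]
  simp_rw [hindicator]
  rw [hscale, intervalIntegral.mul_integral_comp_mul_right, zero_mul, one_mul,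
    intervalIntegral.integral_of_le ht.1.le, integral_Ioc_eq_integral_Ioo,
    setIntegral_indicator measurableSet_Iio, Ioo_inter_Iio, min_eq_right ht.2.le]

namespace IsRadialMeasure

variable {μ : Measure ℝ}

lemma measurable_sweepKernel (hμ : IsRadialMeasure μ) (K : ℝ) :
    Measurable fun p : ℝ × ℝ => sweepKernel μ K p.1 p.2 := by
  have htail := hμ.antitone_tailMass.measurable
  have hratio : Measurable (sweepRatio μ K) := htail.div (htail.sub (htail.comp (by fun_prop)))
  exact .ite (measurableSet_le (by fun_prop) (by fun_prop)) (hratio.comp measurable_snd)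
    measurable_const

lemma measurable_sweepKernel_mul (hμ : IsRadialMeasure μ) (K t : ℝ) :
    Measurable fun x => ((sweepKernel μ K t (x * t) * x : ℝ) : ℂ) :=
  Complex.measurable_ofReal.comp (((hμ.measurable_sweepKernel K).comp
    (by fun_prop : Measurable fun x : ℝ => (t, x * t))).mul measurable_id)

lemma integral_one_sub_pos (hμ : IsRadialMeasure μ) : 0 < ∫ t, (1 - t) ∂μ := by
  have hnonneg : 0 ≤ᵐ[μ] fun t => 1 - t := hμ.ae_mem.mono fun t ht => sub_nonneg.2 ht.2.le
  have hint : Integrable (fun t => 1 - t) μ :=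
    hμ.integrable_of_bound (by fun_prop) 1 fun t ht => by
      rw [Real.norm_of_nonneg (by linarith [ht.2])]; linarith [ht.1]
  rw [integral_pos_iff_support_of_nonneg_ae hnonneg hint, pos_iff_ne_zero]
  intro hzero
  have hnull : μ (Ioi 0) = 0 := measure_mono_null_ae
    (hμ.ae_mem.mono fun t ht _ => (sub_pos.2 ht.2).ne') hzero
  exact (hμ.tailMass_pos 0 one_pos).ne' (by simp [tailMass, measureReal_def, hnull])

end IsRadialMeasure

namespace IsLowerDoublingMeasure

variable {μ : Measure ℝ} {K : ℝ}

lemma tailMass_sub_pos (hμ : IsLowerDoublingMeasure μ K) {s : ℝ} (hs : s ∈ Ico (0 : ℝ) 1) :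
    0 < tailMass μ s - tailMass μ (1 - (1 - s) / K) := by
  linarith [hμ.tailMass_pos s hs.2, hμ.lower s hs]

lemma sweepRatio_mem_Icc (hμ : IsLowerDoublingMeasure μ K) {s : ℝ} (hs : s ∈ Ico (0 : ℝ) 1) :
    sweepRatio μ K s ∈ Icc (0 : ℝ) 2 := by
  have hpos := hμ.tailMass_sub_pos hs
  refine ⟨div_nonneg (tailMass_nonneg _ _) hpos.le, ?_⟩
  rw [sweepRatio, div_le_iff₀ hpos]
  linarith [hμ.lower s hs]

lemma sweepKernel_mem_Icc (hμ : IsLowerDoublingMeasure μ K) {s : ℝ} (hs : s ∈ Ico (0 : ℝ) 1)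
    (t : ℝ) : sweepKernel μ K t s ∈ Icc (0 : ℝ) 2 := by
  rw [sweepKernel]
  split_ifs
  · exact hμ.sweepRatio_mem_Icc hs
  · simp

lemma norm_sweepKernel_mul_le (hμ : IsLowerDoublingMeasure μ K) {x t : ℝ}
    (hx : x ∈ Ioo (0 : ℝ) 1) (ht : t ∈ Ico (0 : ℝ) 1) :
    ‖((sweepKernel μ K t (x * t) * x : ℝ) : ℂ)‖ ≤ 2 := by
  have hkernel := hμ.sweepKernel_mem_Icc (mul_mem_Ico hx ht) t
  rw [Complex.norm_real, Real.norm_of_nonneg (mul_nonneg hkernel.1 hx.1.le)]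
  exact (mul_le_of_le_one_right hkernel.1 hx.2.le).trans hkernel.2

lemma integral_sweepKernel (hμ : IsLowerDoublingMeasure μ K) {s : ℝ} (hs : s ∈ Ico (0 : ℝ) 1) :
    ∫ t, (Ioi s).indicator (sweepKernel μ K · s) t ∂μ = tailMass μ s := by
  have := hμ.finite
  have hcond (t : ℝ) : 1 - s ≤ K * (1 - t) ↔ t ≤ 1 - (1 - s) / K := by
    rw [le_sub_comm, div_le_iff₀ (by linarith [hμ.one_lt]), mul_comm]
  have hindicator : (Ioi s).indicator (sweepKernel μ K · s) =
      (Ioc s (1 - (1 - s) / K)).indicator fun _ => sweepRatio μ K s := by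
    ext t
    by_cases h₁ : s < t <;> by_cases h₂ : t ≤ 1 - (1 - s) / K <;>
      simp [sweepKernel, indicator, hcond, h₁, h₂]
  have hle : s ≤ 1 - (1 - s) / K := by
    linarith [div_le_self (by linarith [hs.2] : 0 ≤ 1 - s) hμ.one_lt.le]
  have hmass : μ.real (Ioc s (1 - (1 - s) / K)) = tailMass μ s - tailMass μ (1 - (1 - s) / K) := by
    rw [← Ioi_sdiff_Ioi, measureReal_sdiff (Ioi_subset_Ioi hle) measurableSet_Ioi]
    rfl
  rw [hindicator, integral_indicator_const _ measurableSet_Ioc, hmass, smul_eq_mul, sweepRatio,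
    mul_div_cancel₀ _ (hμ.tailMass_sub_pos hs).ne']

lemma integrable_sweepKernel_mul_pow (hμ : IsLowerDoublingMeasure μ K) (k : ℕ) :
    Integrable (fun p : ℝ × ℝ =>
      (Ioi p.2).indicator (sweepKernel μ K · p.2) p.1 * ((2 * k + 2) * p.2 ^ (2 * k + 1)))
      (μ.prod (volume.restrict (Ioo 0 1))) := by
  have := hμ.finite
  have hmeas : Measurable fun p : ℝ × ℝ => (Ioi p.2).indicator (sweepKernel μ K · p.2) p.1 := by
    simp only [indicator, mem_Ioi]
    exact .ite (measurableSet_lt (by fun_prop) (by fun_prop)) (hμ.measurable_sweepKernel K)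
      measurable_const
  refine .of_bound (hmeas.mul (by fun_prop)).aestronglyMeasurable (2 * (2 * k + 2)) ?_
  filter_upwards [Measure.quasiMeasurePreserving_snd.ae (ae_restrict_mem measurableSet_Ioo)]
    with p hp
  have hkernel := hμ.sweepKernel_mem_Icc ⟨hp.1.le, hp.2⟩ p.1
  rw [norm_mul, Real.norm_of_nonneg (mul_nonneg (by positivity) (pow_nonneg hp.1.le _))]
  refine mul_le_mul ?_ (mul_le_of_le_one_right (by positivity) (pow_le_one₀ hp.1.le hp.2.le))
    (mul_nonneg (by positivity) (pow_nonneg hp.1.le _)) zero_le_two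
  refine (norm_indicator_le_norm_self _ _).trans ?_
  rw [Real.norm_of_nonneg hkernel.1]
  exact hkernel.2

lemma integral_sweepMultiplier (hμ : IsLowerDoublingMeasure μ K) (k : ℕ) :
    ∫ t, sweepMultiplier μ K k t * t ^ (2 * (k + 1)) ∂μ = evenMoment μ (k + 1) := by
  have := hμ.finite
  rw [integral_congr_ae (hμ.ae_mem.mono fun t ht => sweepMultiplier_mul_pow μ K k ht),
    integral_integral_swap (hμ.integrable_sweepKernel_mul_pow k), hμ.evenMoment_succ_eq_integral]
  refine setIntegral_congr_fun measurableSet_Ioo fun s hs => ?_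
  rw [integral_mul_const, hμ.integral_sweepKernel ⟨hs.1.le, hs.2⟩]

lemma abs_sweepMultiplier_le (hμ : IsLowerDoublingMeasure μ K) (k : ℕ) {t : ℝ}
    (ht : t ∈ Ico (0 : ℝ) 1) : |sweepMultiplier μ K k t| ≤ 4 * (k + 1) := by
  have hbound : ∀ x ∈ Ioo (0 : ℝ) 1,
      ‖(2 * k + 2) * (sweepKernel μ K t (x * t) * x ^ (2 * k + 1))‖ ≤ (2 * k + 2) * 2 := by
    intro x hx
    have hkernel := hμ.sweepKernel_mem_Icc (mul_mem_Ico hx ht) t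
    have hpow : 0 ≤ x ^ (2 * k + 1) := pow_nonneg hx.1.le _
    rw [Real.norm_of_nonneg (mul_nonneg (by positivity) (mul_nonneg hkernel.1 hpow))]
    gcongr
    exact (mul_le_of_le_one_right hkernel.1 (pow_le_one₀ hx.1.le hx.2.le)).trans hkernel.2
  have hnorm := norm_setIntegral_le_of_norm_le_const (μ := volume) (by simp) hbound
  rw [Real.volume_real_Ioo_of_le zero_le_one] at hnorm
  rw [← Real.norm_eq_abs, sweepMultiplier]
  linarith

lemma hasSum_sweep (hμ : IsLowerDoublingMeasure μ K) {h : ℂ → ℂ}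
    (hd : DifferentiableOn ℂ h (ball 0 1)) {ξ : ℂ} (hξ : ξ ∈ ball (0 : ℂ) 1) :
    HasSum (fun k => taylorCoeff h (k + 1) * sweepMultiplier μ K k ‖ξ‖ * ξ ^ (k + 1))
      (sweep μ K (deriv h) ξ) := by
  have ht : ‖ξ‖ ∈ Ico (0 : ℝ) 1 := ⟨norm_nonneg _, mem_ball_zero_iff.1 hξ⟩
  have hd' : DifferentiableOn ℂ (deriv h) (ball 0 1) := hd.deriv isOpen_ball
  have hkernel : Integrable (fun x => ((sweepKernel μ K ‖ξ‖ (x * ‖ξ‖) * x : ℝ) : ℂ))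
      (volume.restrict (Ioo 0 1)) :=
    .of_bound (hμ.measurable_sweepKernel_mul K ‖ξ‖).aestronglyMeasurable 2
      ((ae_restrict_mem measurableSet_Ioo).mono fun x hx => hμ.norm_sweepKernel_mul_le hx ht)
  have hsum := (hasSum_integral_mul_powerSeries hkernel
    (by fun_prop : Continuous fun x : ℝ => (x : ℂ) ^ 2 * ξ).aestronglyMeasurable
    ((ae_restrict_mem measurableSet_Ioo).mono fun x hx => norm_ofReal_sq_mul_le hx ξ)
    (summable_norm_taylorCoeff hd' ht)).mul_left (2 * ξ)
  convert! hsum using 1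
  · ext k
    rw [sweepMultiplier, ← integral_complex_ofReal, taylorCoeff_deriv, ← integral_const_mul,
      ← integral_const_mul, ← integral_const_mul, ← integral_mul_const]
    congr! 2 with x
    push_cast
    ring
  · rw [sweep]
    congr 1
    refine setIntegral_congr_fun measurableSet_Ioo fun x hx => ?_
    have hx' : (x : ℂ) ^ 2 * ξ ∈ ball (0 : ℂ) 1 :=
      mem_ball_zero_iff.2 ((norm_ofReal_sq_mul_le hx ξ).trans_lt ht.2)
    simp only [(hasSum_taylorCoeff hd' hx').tsum_eq]

lemma continuousAt_sweepKernel [NullSingletonClass μ] (hμ : IsLowerDoublingMeasure μ K) {x t : ℝ}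
    (hx : x ∈ Ioo (0 : ℝ) 1) (ht : t ∈ Ico (0 : ℝ) 1) (hne : 1 - x * t ≠ K * (1 - t)) :
    ContinuousAt (fun t => sweepKernel μ K t (x * t)) t := by
  have := hμ.finite
  have htail := continuous_tailMass μ
  have hratio : ContinuousAt (fun t => sweepRatio μ K (x * t)) t := by
    refine ContinuousAt.div ?_ ?_ (hμ.tailMass_sub_pos (mul_mem_Ico hx ht)).ne'
    all_goals exact (by fun_prop : Continuous _).continuousAt
  have hleft : ContinuousAt (fun t => 1 - x * t) t := by fun_prop
  have hright : ContinuousAt (fun t => K * (1 - t)) t := by fun_prop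
  rcases hne.lt_or_gt with hlt | hgt
  · refine hratio.congr ?_
    filter_upwards [hleft.eventually_lt hright hlt] with u hu
    rw [sweepKernel, if_pos hu.le]
  · refine (continuousAt_const (y := (0 : ℝ))).congr ?_
    filter_upwards [hright.eventually_lt hleft hgt] with u hu
    rw [sweepKernel, if_neg hu.not_ge]

lemma continuousAt_sweep [NullSingletonClass μ] (hμ : IsLowerDoublingMeasure μ K) {g : ℂ → ℂ}
    (hg : ContinuousOn g (ball 0 1)) {ξ : ℂ} (hξ : ξ ∈ ball (0 : ℂ) 1) :
    ContinuousAt (sweep μ K g) ξ := by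
  have hξ1 : ‖ξ‖ < 1 := mem_ball_zero_iff.1 hξ
  obtain ⟨R, hξR, hR⟩ := exists_between hξ1
  obtain ⟨B, hB⟩ := (isCompact_closedBall (0 : ℂ) R).exists_bound_of_continuousOn
    (hg.mono (closedBall_subset_ball hR))
  have hnhds : ∀ᶠ η in 𝓝 ξ, ‖η‖ < R := continuous_norm.continuousAt.eventually_lt_const hξR
  have hmem {η : ℂ} {x : ℝ} (hη : ‖η‖ < R) (hx : x ∈ Ioo (0 : ℝ) 1) :
      (x : ℂ) ^ 2 * η ∈ closedBall (0 : ℂ) R :=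
    mem_closedBall_zero_iff.2 ((norm_ofReal_sq_mul_le hx η).trans hη.le)
  refine ContinuousAt.mul (by fun_prop)
    (continuousAt_of_dominated (bound := fun _ => 2 * B) ?_ ?_ (integrable_const _) ?_)
  · filter_upwards [hnhds] with η hη
    refine (hμ.measurable_sweepKernel_mul K ‖η‖).aestronglyMeasurable.mul
      (ContinuousOn.aestronglyMeasurable ?_ measurableSet_Ioo)
    exact hg.comp (by fun_prop) fun x hx => closedBall_subset_ball hR (hmem hη hx)
  · filter_upwards [hnhds] with η hη
    filter_upwards [ae_restrict_mem measurableSet_Ioo] with x hx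
    rw [norm_mul]
    exact mul_le_mul (hμ.norm_sweepKernel_mul_le hx ⟨norm_nonneg η, hη.trans hR⟩)
      (hB _ (hmem hη hx)) (norm_nonneg _) zero_le_two
  · filter_upwards [ae_restrict_of_ae (ae_one_sub_mul_ne hμ.one_lt hξ1),
      ae_restrict_mem measurableSet_Ioo] with x hne hx
    have hkernel : ContinuousAt (fun η : ℂ => sweepKernel μ K ‖η‖ (x * ‖η‖)) ξ :=
      (hμ.continuousAt_sweepKernel hx ⟨norm_nonneg ξ, hξ1⟩ hne).comp' continuous_norm.continuousAt
    have hgx : ContinuousAt (fun η : ℂ => g ((x : ℂ) ^ 2 * η)) ξ :=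
      (hg.continuousAt (isOpen_ball.mem_nhds (closedBall_subset_ball hR (hmem hξR hx)))).comp'
        (by fun_prop)
    exact (Complex.continuous_ofReal.continuousAt.comp' (hkernel.mul continuousAt_const)).mul hgx

lemma norm_sweep_le (hμ : IsLowerDoublingMeasure μ K) {g : ℂ → ℂ} {ξ : ℂ} {B : ℝ} (hB : 0 ≤ B)
    (hξ : ‖ξ‖ < 1) (hg : ∀ x ∈ Ioo (0 : ℝ) 1, 1 - x * ‖ξ‖ ≤ K * (1 - ‖ξ‖) →
      ‖g ((x : ℂ) ^ 2 * ξ)‖ ≤ B) : ‖sweep μ K g ξ‖ ≤ 4 * B * (K * (1 - ‖ξ‖)) := by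
  set S := Ioo (0 : ℝ) 1 ∩ Ici (1 - K * (1 - ‖ξ‖))
  set F : ℝ → ℂ := fun x => ((sweepKernel μ K ‖ξ‖ (x * ‖ξ‖) * x : ℝ) : ℂ) * g ((x : ℂ) ^ 2 * ξ)
    with hF
  have hsupport : ∫ x in Ioo (0 : ℝ) 1, F x = ∫ x in S, F x := by
    refine setIntegral_eq_of_subset_of_forall_sdiff_eq_zero measurableSet_Ioo inter_subset_left
      fun x hx => ?_
    have hx1 : x < 1 - K * (1 - ‖ξ‖) := not_le.1 fun hle => hx.2 ⟨hx.1, hle⟩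
    have hxξ : x * ‖ξ‖ ≤ x := mul_le_of_le_one_right hx.1.1.le hξ.le
    simp only [hF]
    rw [sweepKernel, if_neg (by linarith)]
    simp
  have hbound : ∀ x ∈ S, ‖F x‖ ≤ 2 * B := by
    intro x hx
    by_cases hcond : 1 - x * ‖ξ‖ ≤ K * (1 - ‖ξ‖)
    · rw [norm_mul]
      exact mul_le_mul (hμ.norm_sweepKernel_mul_le hx.1 ⟨norm_nonneg ξ, hξ⟩) (hg x hx.1 hcond)
        (norm_nonneg _) zero_le_two
    · simp only [hF]
      rw [sweepKernel, if_neg hcond]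
      simp [hB]
  have hvolume : volume.real S ≤ K * (1 - ‖ξ‖) := by
    have hsub : S ⊆ Icc (1 - K * (1 - ‖ξ‖)) 1 := fun x hx => ⟨hx.2, hx.1.2.le⟩
    refine (measureReal_mono hsub (by simp)).trans_eq ?_
    rw [Real.volume_real_Icc_of_le (by nlinarith [hμ.one_lt])]
    ring
  have hintegral : ‖∫ x in S, F x‖ ≤ 2 * B * (K * (1 - ‖ξ‖)) :=
    (norm_setIntegral_le_of_norm_le_const
      ((measure_mono inter_subset_left).trans_lt (by simp)) hbound).trans (by gcongr)
  rw [sweep, hsupport, norm_mul, norm_mul, Complex.norm_ofNat]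
  calc 2 * ‖ξ‖ * ‖∫ x in S, F x‖ ≤ 2 * 1 * (2 * B * (K * (1 - ‖ξ‖))) := by gcongr
    _ = 4 * B * (K * (1 - ‖ξ‖)) := by ring

lemma norm_sweep_le_of_bound (hμ : IsLowerDoublingMeasure μ K) {g : ℂ → ℂ} {R ε : ℝ} (hε : 0 ≤ ε)
    (hg : ∀ z : ℂ, ‖z‖ ∈ Ioo R 1 → (1 - ‖z‖ ^ 2) * ‖g z‖ ≤ ε) {ξ : ℂ} (hξ : ‖ξ‖ < 1)
    (hnonneg : 0 ≤ 1 - K * (1 - ‖ξ‖)) (hR : R < (1 - K * (1 - ‖ξ‖)) ^ 2) :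
    ‖sweep μ K g ξ‖ ≤ 4 * K * ε := by
  have hpos : 0 < 1 - ‖ξ‖ := sub_pos.2 hξ
  refine (hμ.norm_sweep_le (B := ε / (1 - ‖ξ‖)) (by positivity) hξ fun x hx hcond => ?_).trans_eq
    (by field_simp)
  have hw := norm_ofReal_sq_mul_le hx ξ
  have hnorm : ‖(x : ℂ) ^ 2 * ξ‖ = x ^ 2 * ‖ξ‖ := by
    rw [norm_mul, norm_pow, Complex.norm_real, Real.norm_of_nonneg hx.1.le]
  have hRw : R < ‖(x : ℂ) ^ 2 * ξ‖ :=
    calc R < (1 - K * (1 - ‖ξ‖)) ^ 2 := hR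
      _ ≤ (x * ‖ξ‖) ^ 2 := by gcongr; linarith
      _ = x ^ 2 * ‖ξ‖ * ‖ξ‖ := by ring
      _ ≤ _ := by rw [hnorm]; exact mul_le_of_le_one_right (by positivity) hξ.le
  rw [le_div_iff₀' hpos]
  refine le_trans ?_ (hg _ ⟨hRw, hw.trans_lt hξ⟩)
  gcongr
  nlinarith [norm_nonneg ((x : ℂ) ^ 2 * ξ)]

lemma tendsto_sweep (hμ : IsLowerDoublingMeasure μ K) {g : ℂ → ℂ}
    (hg : Tendsto (fun z => (1 - ‖z‖ ^ 2) * ‖g z‖) (comap norm (𝓝[<] 1)) (𝓝 0)) :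
    Tendsto (sweep μ K g) (comap norm (𝓝[<] 1)) (𝓝 0) := by
  have hK : 0 < K := one_pos.trans hμ.one_lt
  rw [tendsto_zero_iff_norm_tendsto_zero, Metric.tendsto_nhds]
  intro ε hε
  have hev := hg.eventually_lt_const (by positivity : 0 < ε / 2 / (4 * K))
  rw [eventually_comap] at hev
  obtain ⟨R, hR1, hR⟩ := (mem_nhdsLT_iff_exists_Ioo_subset (a := (1 : ℝ))).1 hev
  have hnear : ∀ᶠ t in 𝓝[<] (1 : ℝ), 0 < 1 - K * (1 - t) ∧ R < (1 - K * (1 - t)) ^ 2 :=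
    ((Continuous.tendsto' (by fun_prop) 1 1 (by simp)).eventually_const_lt one_pos |>.and <|
      (Continuous.tendsto' (by fun_prop) 1 1 (by simp)).eventually_const_lt hR1).filter_mono
      nhdsWithin_le_nhds
  filter_upwards [tendsto_comap.eventually (hnear.and self_mem_nhdsWithin)] with ξ hξ
  rw [dist_zero_right, norm_norm]
  calc ‖sweep μ K g ξ‖ ≤ 4 * K * (ε / 2 / (4 * K)) := hμ.norm_sweep_le_of_bound (by positivity)
        (fun z hz => (hR hz z rfl).le) hξ.2 hξ.1.1.le hξ.1.2
    _ < ε := by field_simp; linarith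

end IsLowerDoublingMeasure

/-- A continuous function whose Bergman projection is `h`. The first summand takes care of all
Taylor coefficients of positive order, and the second of the constant term. -/
def blochSection (μ : Measure ℝ) (K : ℝ) (h : ℂ → ℂ) (ξ : ℂ) : ℂ :=
  sweep μ K (deriv h) ξ +
    taylorCoeff h 0 * (evenMoment μ 0 / ∫ t, (1 - t) ∂μ : ℝ) * (1 - ‖ξ‖ : ℝ)

/-- The Taylor coefficients of the analytic function with which `blochSection μ K h` agrees on the
circle of radius `t`. -/
def blochSectionCoeff (μ : Measure ℝ) (K : ℝ) (h : ℂ → ℂ) (t : ℝ) : ℕ → ℂ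
  | 0 => taylorCoeff h 0 * (evenMoment μ 0 / ∫ t, (1 - t) ∂μ : ℝ) * (1 - t : ℝ)
  | k + 1 => taylorCoeff h (k + 1) * sweepMultiplier μ K k t

namespace IsLowerDoublingMeasure

variable {μ : Measure ℝ} {K : ℝ} {h : ℂ → ℂ}

lemma hasSum_blochSection (hμ : IsLowerDoublingMeasure μ K)
    (hd : DifferentiableOn ℂ h (ball 0 1)) {ξ : ℂ} (hξ : ξ ∈ ball (0 : ℂ) 1) :
    HasSum (fun n => blochSectionCoeff μ K h ‖ξ‖ n * ξ ^ n) (blochSection μ K h ξ) := by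
  rw [← hasSum_nat_add_iff' 1]
  simpa [blochSectionCoeff, blochSection] using hμ.hasSum_sweep hd hξ

lemma summable_norm_blochSectionCoeff (hμ : IsLowerDoublingMeasure μ K)
    (hd : DifferentiableOn ℂ h (ball 0 1)) {t : ℝ} (ht : t ∈ Ico (0 : ℝ) 1) :
    Summable fun n => ‖blochSectionCoeff μ K h t n‖ * t ^ n := by
  rw [← summable_nat_add_iff 1]
  refine .of_nonneg_of_le (fun k => mul_nonneg (norm_nonneg _) (pow_nonneg ht.1 _))
    (fun k => ?_) ((summable_norm_taylorCoeff (hd.deriv isOpen_ball) ht).mul_left 4)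
  have hderiv : ‖taylorCoeff (deriv h) k‖ = (k + 1) * ‖taylorCoeff h (k + 1)‖ := by
    rw [taylorCoeff_deriv, norm_mul, ← Nat.cast_add_one, Complex.norm_natCast, Nat.cast_add_one]
  rw [blochSectionCoeff, norm_mul, Complex.norm_real, Real.norm_eq_abs, hderiv]
  calc ‖taylorCoeff h (k + 1)‖ * |sweepMultiplier μ K k t| * t ^ (k + 1)
      ≤ ‖taylorCoeff h (k + 1)‖ * (4 * (k + 1)) * t ^ k :=
        mul_le_mul (mul_le_mul_of_nonneg_left (hμ.abs_sweepMultiplier_le k ht) (norm_nonneg _))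
          (pow_le_pow_of_le_one ht.1 ht.2.le k.le_succ) (pow_nonneg ht.1 _) (by positivity)
    _ = 4 * ((k + 1) * ‖taylorCoeff h (k + 1)‖ * t ^ k) := by ring

lemma integral_blochSectionCoeff (hμ : IsLowerDoublingMeasure μ K) (h : ℂ → ℂ) (n : ℕ) :
    ∫ t, blochSectionCoeff μ K h t n * (t : ℂ) ^ (2 * n) ∂μ =
      taylorCoeff h n * evenMoment μ n := by
  rcases n with _ | k
  · simp_rw [blochSectionCoeff, mul_zero, pow_zero, mul_one]
    rw [integral_const_mul, integral_complex_ofReal, mul_assoc, ← Complex.ofReal_mul,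
      div_mul_cancel₀ _ hμ.integral_one_sub_pos.ne']
  · rw [← hμ.integral_sweepMultiplier, ← integral_complex_ofReal, ← integral_const_mul]
    congr! 2
    rw [blochSectionCoeff]
    push_cast
    ring

lemma continuousOn_blochSection [NullSingletonClass μ] (hμ : IsLowerDoublingMeasure μ K)
    (hd : DifferentiableOn ℂ h (ball 0 1)) : ContinuousOn (blochSection μ K h) (ball 0 1) :=
  fun _ hξ => ((hμ.continuousAt_sweep (hd.deriv isOpen_ball).continuousOn hξ).add
    (by fun_prop)).continuousWithinAt

lemma tendsto_blochSection (hμ : IsLowerDoublingMeasure μ K) (hh : MemLittleBloch h) :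
    Tendsto (blochSection μ K h) (comap norm (𝓝[<] 1)) (𝓝 0) := by
  have hradial : Tendsto (fun t : ℝ =>
      taylorCoeff h 0 * (evenMoment μ 0 / ∫ t, (1 - t) ∂μ : ℝ) * (1 - t : ℝ)) (𝓝[<] 1) (𝓝 0) :=
    (Continuous.tendsto' (by fun_prop) 1 0 (by simp)).mono_left nhdsWithin_le_nhds
  have hsum := (hμ.tendsto_sweep hh.2).add (hradial.comp tendsto_comap)
  rwa [add_zero] at hsum

end IsLowerDoublingMeasure

lemma exists_mem_diskCZero_eqOn_diskExtend {φ : ℂ → ℂ} (hφ : ContinuousOn φ (ball 0 1))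
    (hφ0 : Tendsto φ (comap norm (𝓝[<] 1)) (𝓝 0)) :
    ∃ Φ ∈ diskCZero, EqOn (diskExtend Φ) φ (ball 0 1) := by
  have hball : EqOn ((ball (0 : ℂ) 1).indicator φ) φ (ball 0 1) := eqOn_indicator
  have hsphere : EqOn ((ball (0 : ℂ) 1).indicator φ) 0 (sphere 0 1) := by
    intro z hz
    exact indicator_of_notMem (sphere_disjoint_ball.notMem_of_mem_left hz) φ
  have hcont : ContinuousOn ((ball (0 : ℂ) 1).indicator φ) (closedBall 0 1) := by
    intro z hz
    by_cases hzb : z ∈ ball (0 : ℂ) 1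
    · exact ((hφ.congr hball).continuousAt (isOpen_ball.mem_nhds hzb)).continuousWithinAt
    · have hzs : z ∈ sphere (0 : ℂ) 1 := by
        rw [← ball_union_sphere] at hz
        exact hz.resolve_left hzb
      have hle : 𝓝[ball 0 1] z ≤ comap norm (𝓝[<] 1) := by
        rw [← tendsto_iff_comap]
        refine tendsto_nhdsWithin_iff.2 ⟨?_, ?_⟩
        · exact (continuous_norm.tendsto' z 1 (mem_sphere_zero_iff_norm.1 hzs)).mono_left
            nhdsWithin_le_nhds
        · filter_upwards [self_mem_nhdsWithin] with w hw using mem_ball_zero_iff.1 hw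
      rw [← ball_union_sphere, ContinuousWithinAt, indicator_of_notMem hzb, nhdsWithin_union,
        tendsto_sup]
      exact ⟨(hφ0.mono_left hle).congr' hball.symm.eventuallyEq_nhdsWithin,
        tendsto_const_nhds.congr' hsphere.symm.eventuallyEq_nhdsWithin⟩
  refine ⟨⟨_, hcont.domRestrict⟩, fun z hz => hsphere (mem_sphere_zero_iff_norm.2 hz),
    fun z hz => ?_⟩
  rw [diskExtend_apply _ (ball_subset_closedBall hz)]
  exact hball hz

lemma projCoeff_eq_taylorCoeff {ω : ℂ → ℝ} (hω : IsRadialWeight ω) {K : ℝ}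
    (hK : IsLowerDoublingMeasure (radialMeasure ω) K) {h : ℂ → ℂ}
    (hd : DifferentiableOn ℂ h (ball 0 1)) {Φ : ℂ → ℂ} (hΦ : Integrable Φ (weightMeasure ω))
    (heq : EqOn Φ (blochSection (radialMeasure ω) K h) (ball 0 1)) (n : ℕ) :
    projCoeff ω Φ n = taylorCoeff h n := by
  have hcircle : ∀ t ∈ Ioo (0 : ℝ) 1, ∀ θ, Φ (circleMap 0 t θ) =
      ∑' n, blochSectionCoeff (radialMeasure ω) K h t n * circleMap 0 t θ ^ n := by
    intro t ht θ
    have hnorm : ‖circleMap 0 t θ‖ = t := by rw [norm_circleMap_zero, abs_of_pos ht.1]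
    have hmem : circleMap 0 t θ ∈ ball (0 : ℂ) 1 := mem_ball_zero_iff.2 (hnorm.trans_lt ht.2)
    rw [heq hmem, ← (hK.hasSum_blochSection hd hmem).tsum_eq, hnorm]
  have hpos : (evenMoment (radialMeasure ω) n : ℂ) ≠ 0 := mod_cast (hK.evenMoment_pos n).ne'
  rw [projCoeff, hω.integral_powerSeries_mul_conj_pow hΦ
    (fun t ht => hK.summable_norm_blochSectionCoeff hd ⟨ht.1.le, ht.2⟩) hcircle,
    hK.integral_blochSectionCoeff]
  field_simp

theorem IsDoublingWeight.exists_bergmanProjection_eq {ω : ℂ → ℝ} (hω : IsDoublingWeight ω)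
    {h : ℂ → ℂ} (hh : MemLittleBloch h) :
    ∃ Φ ∈ diskCZero, EqOn (bergmanProjection ω (diskExtend Φ)) h (ball 0 1) := by
  obtain ⟨K, hK⟩ := hω.exists_isLowerDoublingMeasure
  have hd : DifferentiableOn ℂ h (ball 0 1) := hh.1.1
  obtain ⟨Φ, hΦ, heq⟩ := exists_mem_diskCZero_eqOn_diskExtend (hK.continuousOn_blochSection hd)
    (hK.tendsto_blochSection hh)
  have hint := hω.toIsRadialWeight.integrable_diskExtend Φ
  refine ⟨Φ, hΦ, fun z hz => (hω.hasSum_bergmanProjection hint hz).unique ?_⟩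
  simp_rw [projCoeff_eq_taylorCoeff hω.toIsRadialWeight hK hd hint heq]
  exact hasSum_taylorCoeff hd hz

end

theorem corollary4p2_general (ω : ℂ → ℝ) (hω : IsDoublingWeight ω)
    (X : Submodule ℂ C(closedBall (0 : ℂ) 1, ℂ)) (hX : diskCZero ≤ X) :
    (∀ z ∈ ball (0 : ℂ) 1, IsReproducingKernelAt ω z (bergmanKernel ω z)) ∧
    (∀ Φ ∈ X, ∀ z ∈ ball (0 : ℂ) 1,
      Integrable (bergmanIntegrand ω (diskExtend Φ) z) diskArea) ∧
    (∃ C : ℝ≥0, ∀ Φ ∈ X,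
      MemLittleBloch (bergmanProjection ω (diskExtend Φ)) ∧
      blochNorm (bergmanProjection ω (diskExtend Φ)) ≤ C * ‖Φ‖ₑ) ∧
    (∀ h : ℂ → ℂ, MemLittleBloch h →
      ∃ Φ ∈ X, EqOn (bergmanProjection ω (diskExtend Φ)) h (ball 0 1)) := by
  have hr := hω.toIsRadialWeight
  have hμ := hr.isUpperDoublingMeasure hω.upper
  obtain ⟨M, hM⟩ := hr.exists_blochNorm_bergmanProjection_le hμ
  refine ⟨fun z hz => hr.isReproducingKernelAt_bergmanKernel hz,
    fun Φ _ z hz => hr.integrable_bergmanIntegrand (hr.integrable_diskExtend Φ) hz,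
    ⟨M, fun Φ _ => ⟨hr.memLittleBloch_bergmanProjection hμ Φ,
      hM (diskExtend Φ) ‖Φ‖₊ (continuousOn_diskExtend Φ) fun z hz => norm_diskExtend_le Φ hz⟩⟩,
    fun h hh => ?_⟩
  obtain ⟨Φ, hΦ, heq⟩ := hω.exists_bergmanProjection_eq hh
  exact ⟨Φ, hX hΦ, heq⟩

theorem corollary4p2 (ω : ℂ → ℝ) (hω : IsDoublingWeight ω)
    (X : Submodule ℂ C(closedBall (0 : ℂ) 1, ℂ)) (hX : X = ⊤ ∨ X = diskCZero) :
    -- the Bergman kernel and the Bergman projection are well defined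
    (∀ z ∈ ball (0 : ℂ) 1, IsReproducingKernelAt ω z (bergmanKernel ω z)) ∧
    (∀ Φ ∈ X, ∀ z ∈ ball (0 : ℂ) 1,
      Integrable (bergmanIntegrand ω (diskExtend Φ) z) diskArea) ∧
    -- `P_ω : X → B₀` is bounded
    (∃ C : ℝ≥0, ∀ Φ ∈ X,
      MemLittleBloch (bergmanProjection ω (diskExtend Φ)) ∧
      blochNorm (bergmanProjection ω (diskExtend Φ)) ≤ C * ‖Φ‖ₑ) ∧
    -- and onto
    (∀ h : ℂ → ℂ, MemLittleBloch h →
      ∃ Φ ∈ X, EqOn (bergmanProjection ω (diskExtend Φ)) h (ball 0 1)) := by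
  exact corollary4p2_general ω hω X (by rcases hX with rfl | rfl <;> simp)
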